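/- **Setting.** Let $V$ be a real Banach space, $T_0>0$. For $0<T\le T_0$ let $\mathbb T^2_+(T)=\{(s,t): 0\le s\le t\le T\}$. * A control $\omega:\mathbb T^2_+(T_0)\to[0,\infty)$ satisfies $\omega_{r,s}+\omega_{s,t}\le\omega_{r,t}$ for $r\le s\le t$, vanishes on the diagonal and is continuous at the diagonal. For $s\ge t$ put $\omega_{s,t}:=\omega_{t,s}$. * A remainder $\varpi:[0,\infty)\to[0,\infty)$ is continuous, non-decreasing, with $2\varpi(x/2)\le\varkappa\varpi(x)$ for all $x>0$, for some $0<\varkappa<1$. * $T\mapsto\delta_T\ge 0$ is non-decreasing on $[0,\infty)$ with $\lim_{T\to0}\delta_T=0$. A function $f:V\to V$ satisfies a 4-points control with $(\widehat f,\check f)$, where $\widehat f:[0,\infty)\to[0,\infty)$ is continuous and non-decreasing and $\check f\ge 0$ is a constant, if for all $a,b,c,d\in V$ $$|f(a)-f(b)-f(c)+f(d)|\le \widehat f(|a-b|\vee|c-d|)\,(|a-c|\vee|b-d|)+\check f\,|a-b-c+d| .$$ A family $(\phi_{t,s})_{0\le s\le t\le T}$ of continuous maps $V\to V$ is a *stable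 almost flow* on $[0,T]$ (with respect to $\delta,\varpi,\omega$) if 1. $\phi_{t,t}=\mathrm{id}$, and for every $0<U\le T$ and $0\le s\le t\le U$: $\sup_a|\phi_{t,s}(a)-a|\le\delta_U$ and $|\phi_{t,s}(b)-\phi_{t,s}(a)|\le(1+\delta_U)|b-a|$; 2. with $\phi_{t,s,r}:=\phi_{t,s}\circ\phi_{s,r}-\phi_{t,r}$ there are constants $M,C\ge0$ such that $\sup_a|\phi_{t,s,r}(a)|\le M\varpi(\omega_{r,t})$ and $|\phi_{t,s,r}(a)-\phi_{t,s,r}(b)|\le C\varpi(\omega_{r,t})|a-b|$ for all $r\le s\le t$ in $[0,T]$; 3. each $\phi_{t,s}$ satisfies a 4-points control with some $(\widehat\phi_{t,s},\check\phi_{t,s})$ such that $\check\phi_{t,s}\le1+\delta_U$ whenever $0\le s\le t\le U\le T$, $U>0$; $\widehat\phi_{t,s}\le\widehat\phi_{v,u}$ whenever $[s,t]\subset[u,v]$; and for every $\alpha\ge0$ there is $K_\alpha\ge0$ with $\widehat\phi_{t,s}(\alpha\varpi(\omega_{s,t}))\le K_\alpha\varpi(\omega_{s,t})$ for all $s\le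 t$. A *reverse* stable almost flow $(\zeta_{s,t})_{0\le s\le t\le T}$ is defined in the same way with the order of time reversed (for instance, the quantities in 2 become $\zeta_{r,s}\circ\zeta_{s,t}-\zeta_{r,t}$ for $r\le s\le t$). Two families of continuous maps (both indexed as $\phi_{t,s}$, or both as $\zeta_{s,t}$, $s\le t$) are in the same *galaxy* on $[0,T]$ if their sup-distance at the indices $s\le t$ is at most $C\varpi(\omega_{s,t})$ for a constant $C$ and all $0\le s\le t\le T$. A *flow* on $[0,T]$ is a family $(\psi_{t,s})_{s,t\in[0,T]}$ of maps $V\to V$ with $\psi_{t,t}=\mathrm{id}$, $\psi_{t,s}$ and $\psi_{s,t}$ inverse to each other, and $\psi_{t,s}\circ\psi_{s,r}=\psi_{t,r}$ for $r\le s\le t$ and for $r\ge s\ge t$. It belongs to a galaxy of families indexed as $\phi_{t,s}$ (resp. $\zeta_{s,t}$), $s\le t$, if its restriction to those indices does. **Proposition.** Let $\phi$ be a stable almost flow on $[0,T_0]$, with 4-points controls $(\widehat\phi_{t,s},\check\phi_{t,s})$ as in 3. Put $\chi_{t,s}:=\phi_{t,s}-\mathrm{id}$ and assume that, for all $0\le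 s\le t\le T_0$, $\chi_{t,s}$ satisfies a 4-points control with $(\widehat\phi_{t,s},\ \check\phi_{t,s}-1)$, and that for every $0<T\le T_0$ and $0\le s\le t\le T$ the map $\chi_{t,s}$ is Lipschitz with constant $\delta_T$. Then: (i) for every $0<T\le T_0$ with $\delta_T<1$, each $\phi_{t,s}$, $0\le s\le t\le T$, is invertible, and $\zeta_{s,t}:=\phi_{t,s}^{-1}$ is a reverse stable almost flow on $[0,T]$ with $\delta$ replaced by $\delta'=\delta/(1-\delta)$; (ii) there is $T_1\in(0,T_0]$ with $\delta_{T_1}<1$ such that for every $0<T\le T_1$ the galaxy of $\phi$ on $[0,T]$ contains a unique flow $\psi$, and the galaxy of $\zeta$ on $[0,T]$ contains a unique flow, which equals $\psi^{-1}$, i.e. $(\psi_{t,s}^{-1})$, at the indices $(s,t)$. -/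

import Mathlib

open Set Filter Topology

/-- A control on `{0 ≤ s ≤ t ≤ T}`: non-negative, super-additive, zero on the diagonal and
continuous at the points of the diagonal. -/
structure IsControl (T : ℝ) (ω : ℝ → ℝ → ℝ) : Prop where
  nonneg : ∀ s t, 0 ≤ s → s ≤ t → t ≤ T → 0 ≤ ω s t
  superadd : ∀ r s t, 0 ≤ r → r ≤ s → s ≤ t → t ≤ T → ω r s + ω s t ≤ ω r t
  diag : ∀ s ∈ Icc 0 T, ω s s = 0
  cont_diag : ∀ u ∈ Icc 0 T,
    ContinuousWithinAt (fun p : ℝ × ℝ => ω p.1 p.2) {p | 0 ≤ p.1 ∧ p.1 ≤ p.2 ∧ p.2 ≤ T} (u, u)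

/-- A remainder `ϖ : [0,∞) → [0,∞)`. -/
structure IsRemainder (ϖ : ℝ → ℝ) : Prop where
  nonneg : ∀ x, 0 ≤ x → 0 ≤ ϖ x
  cont : ContinuousOn ϖ (Ici 0)
  mono : MonotoneOn ϖ (Ici 0)
  contract : ∃ κ : ℝ, 0 < κ ∧ κ < 1 ∧ ∀ x, 0 < x → 2 * ϖ (x / 2) ≤ κ * ϖ x

/-- A function `T ↦ δ_T` on `[0,∞)`: non-negative, non-decreasing, tending to `0` at `0`. -/
structure IsModulus (δ : ℝ → ℝ) : Prop where
  nonneg : ∀ x, 0 ≤ x → 0 ≤ δ x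
  mono : MonotoneOn δ (Ici 0)
  tendsto : Tendsto δ (𝓝[>] 0) (𝓝 0)

/-- The value of a control on the interval with endpoints `s`, `t`, given in either order. -/
def ctrl (ω : ℝ → ℝ → ℝ) (s t : ℝ) : ℝ := ω (min s t) (max s t)

section Families

variable {V : Type*} [NormedAddCommGroup V] [NormedSpace ℝ V]

/-! Families are written `φ t s : V → V`.  The relation `R` is the orientation of time:
`R = (· ≤ ·)` for families indexed by `s ≤ t` and triples `r ≤ s ≤ t`, and `R = (· ≥ ·)` for
(reverse) families indexed by `s ≥ t` and triples `r ≥ s ≥ t`. -/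

/-- Each map `φ t s`, for `s, t ∈ [0,T]` with `R s t`, is continuous. -/
def IsFamily (R : ℝ → ℝ → Prop) (T : ℝ) (φ : ℝ → ℝ → V → V) : Prop :=
  ∀ s ∈ Icc 0 T, ∀ t ∈ Icc 0 T, R s t → Continuous (φ t s)

/-- `φ` and `ψ` are families of continuous maps lying in the same galaxy over `[0,T]`. -/
def SameGalaxy (R : ℝ → ℝ → Prop) (T : ℝ) (ϖ : ℝ → ℝ) (ω : ℝ → ℝ → ℝ)
    (φ ψ : ℝ → ℝ → V → V) : Prop :=
  IsFamily R T φ ∧ IsFamily R T ψ ∧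
    ∃ C : ℝ, ∀ s ∈ Icc 0 T, ∀ t ∈ Icc 0 T, R s t →
      ∀ a, ‖φ t s a - ψ t s a‖ ≤ C * ϖ (ctrl ω s t)

/-- The oriented almost flows on `[0,T]`; the estimates involving `δ` hold on each `[0,U]`,
`0 < U ≤ T`, with the value `δ U`. -/
structure IsAlmostFlowDir (R : ℝ → ℝ → Prop) (T : ℝ) (δ η : ℝ → ℝ) (γ : ℝ) (ϖ : ℝ → ℝ)
    (ω : ℝ → ℝ → ℝ) (φ : ℝ → ℝ → V → V) : Prop where
  family : IsFamily R T φ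
  refl : ∀ t ∈ Icc 0 T, φ t t = id
  near_id : ∀ U ∈ Ioc 0 T, ∀ s ∈ Icc 0 U, ∀ t ∈ Icc 0 U, R s t →
    ∀ a, ‖φ t s a - a‖ ≤ δ U
  regular : ∀ U ∈ Ioc 0 T, ∀ s ∈ Icc 0 U, ∀ t ∈ Icc 0 U, R s t →
    ∀ a b, ‖φ t s b - φ t s a‖ ≤ (1 + δ U) * ‖b - a‖ + η (ctrl ω s t) * ‖b - a‖ ^ γ
  almost : ∃ M : ℝ, 0 ≤ M ∧ ∀ r ∈ Icc 0 T, ∀ s ∈ Icc 0 T, ∀ t ∈ Icc 0 T, R r s → R s t →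
    ∀ a, ‖φ t s (φ s r a) - φ t r a‖ ≤ M * ϖ (ctrl ω r t)

/-- `f` satisfies a 4-points control with the function `fhat` and the constant `fcheck`. -/
structure FourPointsControl (f : V → V) (fhat : ℝ → ℝ) (fcheck : ℝ) : Prop where
  hat_nonneg : ∀ x, 0 ≤ x → 0 ≤ fhat x
  hat_mono : MonotoneOn fhat (Ici 0)
  hat_cont : ContinuousOn fhat (Ici 0)
  check_nonneg : 0 ≤ fcheck
  bound : ∀ a b c d : V, ‖f a - f b - f c + f d‖ ≤
    fhat (max ‖a - b‖ ‖c - d‖) * max ‖a - c‖ ‖b - d‖ + fcheck * ‖a - b - c + d‖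

/-- `φ` satisfies a `ϖ`-compatible 4-points control with `(hat t s)` and `(check t s)`. -/
structure CompatibleFourPoints (R : ℝ → ℝ → Prop) (T : ℝ) (ϖ : ℝ → ℝ) (ω : ℝ → ℝ → ℝ)
    (φ : ℝ → ℝ → V → V) (hat : ℝ → ℝ → ℝ → ℝ) (check : ℝ → ℝ → ℝ) : Prop where
  control : ∀ s ∈ Icc 0 T, ∀ t ∈ Icc 0 T, R s t →
    FourPointsControl (φ t s) (hat t s) (check t s)
  /- monotonicity with respect to the inclusion of the interval with endpoints `s, t` in
  the one with endpoints `u, v` -/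
  hat_le : ∀ u ∈ Icc 0 T, ∀ s ∈ Icc 0 T, ∀ t ∈ Icc 0 T, ∀ v ∈ Icc 0 T,
    R u s → R s t → R t v → ∀ x, 0 ≤ x → hat t s x ≤ hat v u x
  compat : ∀ α : ℝ, 0 ≤ α → ∃ K : ℝ, 0 ≤ K ∧ ∀ s ∈ Icc 0 T, ∀ t ∈ Icc 0 T, R s t →
    hat t s (α * ϖ (ctrl ω s t)) ≤ K * ϖ (ctrl ω s t)

/-- Oriented stable almost flows with prescribed 4-points control.  Here `γ = 1`, so that the
`η`-term of an almost flow is absorbed in `δ`: `φ t s` is Lipschitz with constant `1 + δ U`. -/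
structure IsStableDirWith (R : ℝ → ℝ → Prop) (T : ℝ) (δ ϖ : ℝ → ℝ) (ω : ℝ → ℝ → ℝ)
    (φ : ℝ → ℝ → V → V) (hat : ℝ → ℝ → ℝ → ℝ) (check : ℝ → ℝ → ℝ) : Prop where
  almostFlow : IsAlmostFlowDir R T δ 0 1 ϖ ω φ
  fourPoints : CompatibleFourPoints R T ϖ ω φ hat check
  check_le : ∀ U ∈ Ioc 0 T, ∀ s ∈ Icc 0 U, ∀ t ∈ Icc 0 U, R s t → check t s ≤ 1 + δ U
  lip : ∃ C : ℝ, 0 ≤ C ∧ ∀ r ∈ Icc 0 T, ∀ s ∈ Icc 0 T, ∀ t ∈ Icc 0 T, R r s → R s t →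
    ∀ a b, ‖(φ t s (φ s r a) - φ t r a) - (φ t s (φ s r b) - φ t r b)‖ ≤
      C * ϖ (ctrl ω r t) * ‖a - b‖

/-- Stable almost flow on `[0,T]`, with a given 4-points control. -/
def IsStableAlmostFlowWith (T : ℝ) (δ ϖ : ℝ → ℝ) (ω : ℝ → ℝ → ℝ)
    (φ : ℝ → ℝ → V → V) (hat : ℝ → ℝ → ℝ → ℝ) (check : ℝ → ℝ → ℝ) : Prop :=
  IsStableDirWith (· ≤ ·) T δ ϖ ω φ hat check

/-- Reverse stable almost flow on `[0,T]`. -/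
def IsReverseStableAlmostFlow (T : ℝ) (δ ϖ : ℝ → ℝ) (ω : ℝ → ℝ → ℝ)
    (ζ : ℝ → ℝ → V → V) : Prop :=
  ∃ hat check, IsStableDirWith (· ≥ ·) T δ ϖ ω ζ hat check

/-- A flow on `[0,T]`: a family `ψ t s`, `s, t ∈ [0,T]` in either order. -/
structure IsFlow (T : ℝ) (ψ : ℝ → ℝ → V → V) : Prop where
  refl : ∀ t ∈ Icc 0 T, ψ t t = id
  inv : ∀ s ∈ Icc 0 T, ∀ t ∈ Icc 0 T, s ≤ t → ψ s t ∘ ψ t s = id ∧ ψ t s ∘ ψ s t = id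
  comp : ∀ r ∈ Icc 0 T, ∀ s ∈ Icc 0 T, ∀ t ∈ Icc 0 T,
    (r ≤ s ∧ s ≤ t) ∨ (r ≥ s ∧ s ≥ t) → ψ t s ∘ ψ s r = ψ t r

/-- `ψ` is, over `[0,T]`, the one and only flow in the galaxy of `φ`. -/
def IsUniqueFlowInGalaxy (R : ℝ → ℝ → Prop) (T : ℝ) (ϖ : ℝ → ℝ) (ω : ℝ → ℝ → ℝ)
    (φ ψ : ℝ → ℝ → V → V) : Prop :=
  IsFlow T ψ ∧ SameGalaxy R T ϖ ω φ ψ ∧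
    ∀ θ : ℝ → ℝ → V → V, IsFlow T θ → SameGalaxy R T ϖ ω φ θ →
      ∀ s ∈ Icc 0 T, ∀ t ∈ Icc 0 T, θ t s = ψ t s

/-- The family of inverses, with reversed indices: `(invFamily φ) s t = (φ t s)⁻¹`
(meaningful where `φ t s` is bijective). -/
noncomputable def invFamily (φ : ℝ → ℝ → V → V) : ℝ → ℝ → V → V :=
  fun s t => Function.invFun (φ t s)

end Families

/-! ### Remainders and controls -/

/-! One fact serves both halves: if `g - id` is Lipschitz with constant `k < 1`, then `g` is
bijective and its inverse is `1 / (1 - k)`-Lipschitz (`bijective_of_sub_id_lip`,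
`norm_le_of_sub_id_lip`).

For (i), every estimate on the inverses is an estimate on `φ` read at preimages. The 4-points
control is inverted by writing `id = φ - χ` and absorbing the term in `check - 1 < 1`
(`FourPointsControl.norm_le_of_sub_id`).

For (ii), `φ` is composed along partitions. A partition can be cut at one step into two blocks of at
most half the control, so each block costs only `κ / 2` times the remainder. Induction on the number
of steps then bounds the distance from the composition to `φ`, in sup norm
(`UniformStable.norm_iterComp_sub_le`) and in Lipschitz seminorm (`UniformStable.lip_iterComp_sub`).
On a short interval all compositions are therefore uniform contractive perturbations of the
identity. Since `ϖ x = o(x)`, the sum of `ϖ (ω ..)` along a partition vanishes with the mesh. Hence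
the compositions along dyadic grids converge to maps that compose as a flow (`exists_sewing`), and
these are invertible by the initial fact.

Uniqueness is a telescoping argument with the same vanishing sum (`IsFlow.eq_of_norm_sub_le`). As
`φ` and its inverses are Lipschitz, closeness to the inverses is equivalent to closeness to `φ`, so
the reverse galaxy reduces to the forward one. -/

theorem IsRemainder.half_le {ϖ : ℝ → ℝ} (h : IsRemainder ϖ) :
    ∃ κ : ℝ, 0 < κ ∧ κ < 1 ∧ ∀ x y, 0 ≤ x → 0 ≤ y → x ≤ y / 2 → ϖ x ≤ κ / 2 * ϖ y := by
  obtain ⟨κ, h0, h1, hc⟩ := h.contract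
  refine ⟨κ, h0, h1, fun x y hx hy hxy => ?_⟩
  rcases hy.eq_or_lt with rfl | hy
  · have hx0 : x = 0 := by linarith
    subst hx0
    -- The contraction inequality is given only for `x > 0`; its limit at `0` yields `2 * ϖ 0 ≤ κ *
    -- ϖ 0`.
    have hlim : Tendsto ϖ (𝓝[>] 0) (𝓝 (ϖ 0)) :=
      (h.cont 0 (by simp)).mono_left (nhdsWithin_mono _ Ioi_subset_Ici_self)
    have hhalf : Tendsto (fun x : ℝ => x / 2) (𝓝[>] 0) (𝓝[>] 0) := by
      refine tendsto_nhdsWithin_iff.2 ⟨?_, ?_⟩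
      · have : Tendsto (fun x : ℝ => x / 2) (𝓝 0) (𝓝 (0 / 2)) :=
          (continuous_id.div_const 2).tendsto 0
        simpa using this.mono_left nhdsWithin_le_nhds
      · filter_upwards [self_mem_nhdsWithin] with x hx
        exact half_pos (mem_Ioi.1 hx)
    have := le_of_tendsto_of_tendsto ((hlim.comp hhalf).const_mul 2) (hlim.const_mul κ)
      (by filter_upwards [self_mem_nhdsWithin] with x hx using hc x hx)
    linarith
  · have h2 := h.mono (mem_Ici.2 hx) (mem_Ici.2 (half_pos hy).le) hxy
    have h3 := hc y hy
    linarith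

theorem IsRemainder.zero {ϖ : ℝ → ℝ} (h : IsRemainder ϖ) : ϖ 0 = 0 := by
  obtain ⟨κ, h0, h1, hc⟩ := h.half_le
  have h2 := hc 0 0 le_rfl le_rfl (by simp)
  have h3 := h.nonneg 0 le_rfl
  nlinarith

/-- Halving `n` times from `1` gives `ϖ (2⁻ⁿ) ≤ (κ / 2) ^ n * ϖ 1`. For `y` between `2⁻ⁿ⁻¹` and
`2⁻ⁿ` the ratio `ϖ y / y` is then at most `2 * κ ^ n * ϖ 1`. -/
theorem IsRemainder.eventually_le_mul {ϖ : ℝ → ℝ} (h : IsRemainder ϖ) {e : ℝ} (he : 0 < e) :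
    ∃ x₀, 0 < x₀ ∧ ∀ y, 0 ≤ y → y ≤ x₀ → ϖ y ≤ e * y := by
  obtain ⟨κ, h0, h1, hc⟩ := h.half_le
  have hpow : ∀ n : ℕ, ϖ ((1 / 2) ^ n) ≤ (κ / 2) ^ n * ϖ 1 := by
    intro n
    induction n with
    | zero => simp
    | succ n ih =>
      have := hc ((1 / 2) ^ (n + 1)) ((1 / 2) ^ n) (by positivity) (by positivity)
        (by rw [pow_succ]; linarith)
      calc ϖ ((1 / 2) ^ (n + 1)) ≤ κ / 2 * ϖ ((1 / 2) ^ n) := this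
        _ ≤ κ / 2 * ((κ / 2) ^ n * ϖ 1) := by gcongr
        _ = _ := by ring
  have hϖ1 := h.nonneg 1 zero_le_one
  have hlim : Tendsto (fun n : ℕ => 2 * κ ^ n * ϖ 1) atTop (𝓝 0) := by
    simpa using ((tendsto_pow_atTop_nhds_zero_of_lt_one h0.le h1).const_mul 2).mul_const (ϖ 1)
  obtain ⟨N, hN⟩ := (hlim.eventually (gt_mem_nhds he)).exists
  refine ⟨(1 / 2) ^ N, by positivity, fun y hy hyN => ?_⟩
  rcases hy.eq_or_lt with rfl | hy
  · simp [h.zero]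
  have hy1 : y ≤ 1 := hyN.trans (pow_le_one₀ (by norm_num) (by norm_num))
  obtain ⟨n, hn, hn'⟩ := exists_nat_pow_near_of_lt_one hy hy1 (by norm_num : (0 : ℝ) < 1 / 2)
    (by norm_num)
  have hNn : N ≤ n := by
    have := (pow_lt_pow_iff_right_of_lt_one₀ (by norm_num : (0 : ℝ) < 1 / 2)
      (by norm_num)).1 (hn.trans_le hyN)
    omega
  calc ϖ y ≤ ϖ ((1 / 2) ^ n) := h.mono hy.le (mem_Ici.2 (by positivity)) hn'
    _ ≤ (κ / 2) ^ n * ϖ 1 := hpow n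
    _ = κ ^ n * ϖ 1 * (2 * (1 / 2) ^ (n + 1)) := by
        rw [pow_succ, div_pow, one_div, inv_pow]; ring
    _ ≤ κ ^ n * ϖ 1 * (2 * y) := by gcongr
    _ ≤ κ ^ N * ϖ 1 * (2 * y) := by
        have := pow_le_pow_of_le_one h0.le h1.le hNn
        gcongr
    _ = 2 * κ ^ N * ϖ 1 * y := by ring
    _ ≤ e * y := by gcongr

theorem IsControl.mono {T : ℝ} {ω : ℝ → ℝ → ℝ} (h : IsControl T ω) {r s t u : ℝ} (hr : 0 ≤ r)
    (hrs : r ≤ s) (hst : s ≤ t) (htu : t ≤ u) (hu : u ≤ T) : ω s t ≤ ω r u := by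
  have h1 := h.superadd r s t hr hrs hst (htu.trans hu)
  have h2 := h.superadd r t u hr (hrs.trans hst) htu hu
  have h3 := h.nonneg r s hr hrs (by linarith)
  have h4 := h.nonneg t u (by linarith) htu hu
  linarith

theorem IsControl.restrict {T U : ℝ} {ω : ℝ → ℝ → ℝ} (h : IsControl T ω) (hU : U ≤ T) :
    IsControl U ω where
  nonneg s t hs hst ht := h.nonneg s t hs hst (ht.trans hU)
  superadd r s t hr hrs hst ht := h.superadd r s t hr hrs hst (ht.trans hU)
  diag s hs := h.diag s ⟨hs.1, hs.2.trans hU⟩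
  cont_diag u hu := (h.cont_diag u ⟨hu.1, hu.2.trans hU⟩).mono
    fun _ hp => ⟨hp.1, hp.2.1, hp.2.2.trans hU⟩

/-- Continuity at each diagonal point becomes uniform through a Lebesgue number of a cover of the
compact `[0,T]`. -/
theorem IsControl.uniform_diag {T : ℝ} {ω : ℝ → ℝ → ℝ} (h : IsControl T ω) {e : ℝ}
    (he : 0 < e) :
    ∃ η, 0 < η ∧ ∀ s t, 0 ≤ s → s ≤ t → t ≤ T → t - s < η → ω s t < e := by
  have key : ∀ u ∈ Icc 0 T, ∃ ρ > 0, ∀ s t, 0 ≤ s → s ≤ t → t ≤ T →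
      s ∈ Metric.ball u ρ → t ∈ Metric.ball u ρ → ω s t < e := by
    intro u hu
    obtain ⟨ρ, hρ, H⟩ := Metric.continuousWithinAt_iff.1 (h.cont_diag u hu) e he
    refine ⟨ρ, hρ, fun s t hs hst ht hsu htu => ?_⟩
    have := H (x := (s, t)) ⟨hs, hst, ht⟩ (by simpa [Prod.dist_eq] using ⟨hsu, htu⟩)
    rw [h.diag u hu, Real.dist_eq, sub_zero] at this
    exact lt_of_abs_lt this
  choose! ρ hρ H using key
  obtain ⟨η, hη, hball⟩ := lebesgue_number_lemma_of_metric (isCompact_Icc (a := (0 : ℝ)) (b := T))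
    (c := fun u : Icc (0 : ℝ) T => Metric.ball (u : ℝ) (ρ u)) (fun _ => Metric.isOpen_ball)
    (fun u hu => mem_iUnion.2 ⟨⟨u, hu⟩, Metric.mem_ball_self (hρ u hu)⟩)
  refine ⟨η, hη, fun s t hs hst ht hts => ?_⟩
  obtain ⟨u, hu⟩ := hball s ⟨hs, hst.trans ht⟩
  refine H u u.2 s t hs hst ht (hu (Metric.mem_ball_self hη)) (hu ?_)
  rw [Metric.mem_ball, Real.dist_eq, abs_of_nonneg (by linarith)]
  exact hts

theorem IsControl.sum_le {T : ℝ} {ω : ℝ → ℝ → ℝ} (h : IsControl T ω) {τ : ℕ → ℝ}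
    (hτ : Monotone τ) (hτT : ∀ i, τ i ∈ Icc 0 T) (n : ℕ) :
    ∑ i ∈ Finset.range n, ω (τ i) (τ (i + 1)) ≤ ω (τ 0) (τ n) := by
  induction n with
  | zero => simp [h.diag _ (hτT 0)]
  | succ n ih =>
    rw [Finset.sum_range_succ]
    have := h.superadd (τ 0) (τ n) (τ (n + 1)) (hτT 0).1 (hτ (Nat.zero_le n))
      (hτ (Nat.le_succ n)) (hτT _).2
    linarith

/-- On short steps `ϖ (ω ..)` is a small multiple of `ω ..`, and the latter sums to at most `ω 0 T`
by super-additivity. -/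
theorem exists_sum_remainder_le {T : ℝ} (hT : 0 ≤ T) {ω : ℝ → ℝ → ℝ} (hω : IsControl T ω)
    {ϖ : ℝ → ℝ} (hϖ : IsRemainder ϖ) {e : ℝ} (he : 0 < e) :
    ∃ η, 0 < η ∧ ∀ (τ : ℕ → ℝ) (n : ℕ), Monotone τ → (∀ i, τ i ∈ Icc 0 T) →
      (∀ i, τ (i + 1) - τ i < η) →
      ∑ i ∈ Finset.range n, ϖ (ω (τ i) (τ (i + 1))) ≤ e := by
  have hω0 := hω.nonneg 0 T le_rfl hT le_rfl
  obtain ⟨x₀, hx₀, hle⟩ := hϖ.eventually_le_mul (e := e / (ω 0 T + 1)) (by positivity)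
  obtain ⟨η, hη, hlt⟩ := hω.uniform_diag hx₀
  refine ⟨η, hη, fun τ n hτ hτT hmesh => ?_⟩
  have hstep := fun i => hτ (Nat.le_succ i)
  calc ∑ i ∈ Finset.range n, ϖ (ω (τ i) (τ (i + 1)))
      ≤ ∑ i ∈ Finset.range n, e / (ω 0 T + 1) * ω (τ i) (τ (i + 1)) :=
        Finset.sum_le_sum fun i _ => hle _
          (hω.nonneg _ _ (hτT i).1 (hstep i) (hτT _).2)
          (hlt _ _ (hτT i).1 (hstep i) (hτT _).2 (hmesh i)).le
    _ = e / (ω 0 T + 1) * ∑ i ∈ Finset.range n, ω (τ i) (τ (i + 1)) := by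
        rw [Finset.mul_sum]
    _ ≤ e / (ω 0 T + 1) * (ω 0 T + 1) := by
        have h1 := hω.sum_le hτ hτT n
        have h2 := hω.mono le_rfl (hτT 0).1 (hτ (Nat.zero_le n)) (hτT n).2 le_rfl
        gcongr
        linarith
    _ = e := by field_simp

/-- A partition splits at one of its steps into two parts of at most half the control. -/
theorem IsControl.exists_split {T : ℝ} {ω : ℝ → ℝ → ℝ} (h : IsControl T ω) {τ : ℕ → ℝ}
    (hτ : Monotone τ) (hτT : ∀ i, τ i ∈ Icc 0 T) (i n : ℕ) :
    ∃ k m, n + 1 = k + (m + 1) ∧ ω (τ i) (τ (i + k)) ≤ ω (τ i) (τ (i + (n + 1))) / 2 ∧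
      ω (τ (i + k + 1)) (τ (i + (n + 1))) ≤ ω (τ i) (τ (i + (n + 1))) / 2 := by
  classical
  set W := ω (τ i) (τ (i + (n + 1))) with hW
  have hWnn : 0 ≤ W := h.nonneg _ _ (hτT _).1 (hτ (by omega)) (hτT _).2
  have h0 : ω (τ i) (τ (i + 0)) ≤ W / 2 := by
    rw [add_zero, h.diag _ (hτT i)]; linarith
  -- The cut is after the last `k ≤ n` for which the left block has at most half the control. One
  -- more step exceeds half, so super-additivity leaves at most half on the right; if `k = n` the
  -- right block is empty.
  have hk := Nat.findGreatest_spec (P := fun k => ω (τ i) (τ (i + k)) ≤ W / 2) (Nat.zero_le n) h0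
  have hkn := Nat.findGreatest_le (P := fun k => ω (τ i) (τ (i + k)) ≤ W / 2) n
  have hgt := fun k => Nat.findGreatest_is_greatest
    (P := fun k => ω (τ i) (τ (i + k)) ≤ W / 2) (n := n) (k := k)
  set k := Nat.findGreatest (fun k => ω (τ i) (τ (i + k)) ≤ W / 2) n
  refine ⟨k, n - k, by omega, hk, ?_⟩
  rcases hkn.eq_or_lt with hkn | hkn
  · rw [show i + k + 1 = i + (n + 1) by omega, h.diag _ (hτT _)]; linarith
  · have h1 := hgt (k + 1) (by omega) (by omega)
    have h2 := h.superadd (τ i) (τ (i + (k + 1))) (τ (i + (n + 1))) (hτT _).1 (hτ (by omega))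
      (hτ (by omega)) (hτT _).2
    rw [show i + k + 1 = i + (k + 1) by omega]
    push Not at h1
    linarith

/-! ### Composition of sequences of maps -/

/-- `iterComp f i n = f (i + n - 1) ∘ ⋯ ∘ f (i + 1) ∘ f i`. -/
def iterComp {V : Type*} (f : ℕ → V → V) : ℕ → ℕ → V → V
  | _, 0 => id
  | i, n + 1 => iterComp f (i + 1) n ∘ f i

theorem iterComp_add {V : Type*} (f : ℕ → V → V) (i m n : ℕ) :
    iterComp f i (m + n) = iterComp f (i + m) n ∘ iterComp f i m := by
  induction m generalizing i with
  | zero => simp [iterComp]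
  | succ m ih =>
    rw [show m + 1 + n = (m + n) + 1 by omega, iterComp, ih, iterComp,
      show i + 1 + m = i + (m + 1) by omega]
    rfl

theorem iterComp_mul {V : Type*} (f : ℕ → V → V) (k i n : ℕ) :
    iterComp f (k * i) (k * n) = iterComp (fun j => iterComp f (k * j) k) i n := by
  induction n generalizing i with
  | zero => simp [iterComp]
  | succ n ih =>
    rw [show k * (n + 1) = k + k * n by ring, iterComp_add, iterComp, ← ih (i + 1)]
    rfl

theorem iterComp_eq_id {V : Type*} (f : ℕ → V → V) (i n : ℕ) (h : ∀ j, i ≤ j → f j = id) :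
    iterComp f i n = id := by
  induction n generalizing i with
  | zero => rfl
  | succ n ih => rw [iterComp, ih (i + 1) fun j hj => h j (by omega), h i le_rfl]; rfl

/-- Telescoping: the error made at one factor is transported by the later `f`'s only, so no
regularity of `g` is needed. -/
theorem norm_iterComp_sub_le {V : Type*} [NormedAddCommGroup V] {f g : ℕ → V → V} {Λ : ℝ}
    {e : ℕ → ℝ} (hΛ : 0 ≤ Λ)
    (hf : ∀ i n a b, ‖iterComp f i n a - iterComp f i n b‖ ≤ Λ * ‖a - b‖)
    (hfg : ∀ i a, ‖f i a - g i a‖ ≤ e i) (n : ℕ) (a : V) :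
    ‖iterComp f 0 n a - iterComp g 0 n a‖ ≤ Λ * ∑ i ∈ Finset.range n, e i := by
  suffices H : ∀ i, ‖iterComp f i n a - iterComp g i n a‖ ≤
      Λ * ∑ j ∈ Finset.range n, e (i + j) by simpa using H 0
  intro i
  induction n generalizing i a with
  | zero => simp [iterComp]
  | succ n ih =>
    rw [Finset.sum_range_succ', add_zero]
    have h1 := hf (i + 1) n (f i a) (g i a)
    have h2 := ih (g i a) (i + 1)
    have h3 := mul_le_mul_of_nonneg_left (hfg i a) hΛ
    have h4 : ∑ j ∈ Finset.range n, e (i + 1 + j) = ∑ j ∈ Finset.range n, e (i + (j + 1)) :=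
      Finset.sum_congr rfl fun j _ => by rw [add_assoc, add_comm 1 j]
    have h5 := norm_sub_le_norm_sub_add_norm_sub (iterComp f (i + 1) n (f i a))
      (iterComp f (i + 1) n (g i a)) (iterComp g (i + 1) n (g i a))
    rw [h4] at h2
    simp only [iterComp, Function.comp_apply]
    linarith

/-! ### Uniform estimates for compositions along partitions -/

theorem norm_sub_sub_sub_le_add₄ {V : Type*} [NormedAddCommGroup V]
    (p₀ p₁ p₂ p₃ p₄ q₀ q₁ q₂ q₃ q₄ : V) :
    ‖p₀ - p₄ - (q₀ - q₄)‖ ≤ ‖p₀ - p₁ - (q₀ - q₁)‖ + ‖p₁ - p₂ - q₁ + q₂‖ +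
      ‖p₂ - p₃ - q₂ + q₃‖ + ‖(p₃ - p₄) - (q₃ - q₄)‖ := by
  refine le_trans (le_of_eq ?_) (norm_add₄_le ..)
  congr 1; abel

/-- This is the factor of `K` in `UniformStable.lip_iterComp_sub`: the first product comes from the
right block, the second from the left block carried through two maps. The slack `(1 - κ) / 2` pays
for the other terms. -/
theorem contraction_factor_le {κ d : ℝ} (hκ0 : 0 < κ) (hκ1 : κ < 1) (hd0 : 0 ≤ d)
    (hd : d ≤ (1 - κ) / 10) :
    κ / 2 * ((1 + d) * (1 + d + (1 - κ) / 10) + (1 + d) * (1 + d)) ≤ 1 - (1 - κ) / 2 := by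
  have h1 : (1 + d) * (1 + d + (1 - κ) / 10) + (1 + d) * (1 + d) ≤ 2 + 6 * ((1 - κ) / 10) := by
    nlinarith
  calc _ ≤ κ / 2 * (2 + 6 * ((1 - κ) / 10)) := by gcongr
    _ ≤ _ := by nlinarith

/-- The estimates, with explicit constants, of a stable almost flow on `[0,T]`. -/
structure UniformStable {V : Type*} [NormedAddCommGroup V] (T d M C α H : ℝ) (ϖ : ℝ → ℝ)
    (ω : ℝ → ℝ → ℝ) (φ : ℝ → ℝ → V → V) : Prop where
  refl : ∀ t ∈ Icc 0 T, φ t t = id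
  lip : ∀ s t, 0 ≤ s → s ≤ t → t ≤ T → ∀ a b, ‖φ t s a - φ t s b‖ ≤ (1 + d) * ‖a - b‖
  almost : ∀ r s t, 0 ≤ r → r ≤ s → s ≤ t → t ≤ T → ∀ a,
    ‖φ t s (φ s r a) - φ t r a‖ ≤ M * ϖ (ω r t)
  almost_lip : ∀ r s t, 0 ≤ r → r ≤ s → s ≤ t → t ≤ T → ∀ a b,
    ‖(φ t s (φ s r a) - φ t r a) - (φ t s (φ s r b) - φ t r b)‖ ≤ C * ϖ (ω r t) * ‖a - b‖
  four : ∀ r s t v, 0 ≤ r → r ≤ s → s ≤ t → t ≤ v → v ≤ T → ∀ a b c e,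
    ‖a - b‖ ≤ α * ϖ (ω r v) → ‖c - e‖ ≤ α * ϖ (ω r v) →
    ‖φ t s a - φ t s b - φ t s c + φ t s e‖ ≤
      H * ϖ (ω r v) * max ‖a - c‖ ‖b - e‖ + (1 + d) * ‖a - b - c + e‖

/-- The maps `φ (τ (i + 1)) (τ i)` along a partition `τ`. -/
def stepMap {V : Type*} (φ : ℝ → ℝ → V → V) (τ : ℕ → ℝ) (i : ℕ) : V → V :=
  φ (τ (i + 1)) (τ i)

namespace UniformStable

variable {V : Type*} [NormedAddCommGroup V] {T d M C α H : ℝ} {ϖ : ℝ → ℝ}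
  {ω : ℝ → ℝ → ℝ} {φ : ℝ → ℝ → V → V}

/-- The partition is cut into a left block, one step from `s` to `u`, and a right block. The blocks
contribute about `κ * L` together, and the two almost-flow defects fit in the remaining `(1 - κ) *
L`. -/
theorem norm_iterComp_sub_le (h : UniformStable T d M C α H ϖ ω φ) (hω : IsControl T ω)
    (hϖ : IsRemainder ϖ) {κ L : ℝ} (hκ0 : 0 < κ) (hκ1 : κ < 1)
    (hκ : ∀ x y, 0 ≤ x → 0 ≤ y → x ≤ y / 2 → ϖ x ≤ κ / 2 * ϖ y)
    (hd0 : 0 ≤ d) (hd : d ≤ (1 - κ) / 10) (hM : 0 ≤ M) (hL : 6 * M ≤ L * (1 - κ))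
    {τ : ℕ → ℝ} (hτ : Monotone τ) (hτT : ∀ i, τ i ∈ Icc 0 T) (i n : ℕ) (a : V) :
    ‖iterComp (stepMap φ τ) i n a - φ (τ (i + n)) (τ i) a‖ ≤ L * ϖ (ω (τ i) (τ (i + n))) := by
  have hL0 : 0 ≤ L := by nlinarith
  induction n using Nat.strong_induction_on generalizing i a with
  | _ n ih =>
  rcases n with _ | n
  · simp [iterComp, h.refl _ (hτT i), hω.diag _ (hτT i), hϖ.zero]
  obtain ⟨k, m, hn, hk, hm⟩ := hω.exists_split hτ hτT i n
  have e1 : i + k + 1 + m = i + (n + 1) := by omega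
  have ihk := ih k (by omega) i a
  set A := iterComp (stepMap φ τ) i k a with hA
  set B := φ (τ (i + k + 1)) (τ (i + k)) A with hB
  have ihm := ih m (by omega) (i + k + 1) B
  have hcomp : iterComp (stepMap φ τ) i (n + 1) a = iterComp (stepMap φ τ) (i + k + 1) m B := by
    rw [hn, iterComp_add]; rfl
  rw [hcomp]
  rw [e1] at ihm
  have hr0 := (hτT i).1
  have hrs : τ i ≤ τ (i + k) := hτ (by omega)
  have hss : τ (i + k) ≤ τ (i + k + 1) := hτ (by omega)
  have hst : τ (i + k + 1) ≤ τ (i + (n + 1)) := hτ (by omega)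
  have htT := (hτT (i + (n + 1))).2
  generalize τ i = r at *
  generalize τ (i + k) = s at *
  generalize τ (i + k + 1) = u at *
  generalize τ (i + (n + 1)) = t at *
  have hW := hω.nonneg r t hr0 (by linarith) htT
  have hx := hϖ.nonneg _ hW
  have h1 := hκ _ _ (hω.nonneg r s hr0 hrs (by linarith)) hW hk
  have h2 := hκ _ _ (hω.nonneg u t (by linarith) hst htT) hW hm
  have h3 := h.lip u t (by linarith) hst htT B (φ u s (φ s r a))
  have h4 := h.lip s u (by linarith) hss (by linarith) A (φ s r a)
  have h5 := h.lip u t (by linarith) hst htT (φ u s (φ s r a)) (φ u r a)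
  have h6 := h.almost r s u hr0 hrs hss (by linarith) a
  have h7 := h.almost r u t hr0 (by linarith) hst htT a
  have h8 : ϖ (ω r u) ≤ ϖ (ω r t) :=
    hϖ.mono (hω.nonneg r u hr0 (by linarith) (by linarith)) hW
      (hω.mono hr0 le_rfl (by linarith) hst htT)
  rw [← hB] at h4
  set x := ϖ (ω r t)
  have h34 : ‖φ t u B - φ t u (φ u s (φ s r a))‖ ≤ (1 + d) * ((1 + d) * (L * (κ / 2 * x))) :=
    h3.trans (mul_le_mul_of_nonneg_left (h4.trans (mul_le_mul_of_nonneg_left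
      (ihk.trans (mul_le_mul_of_nonneg_left h1 hL0)) (by linarith))) (by linarith))
  have h56 : ‖φ t u (φ u s (φ s r a)) - φ t u (φ u r a)‖ ≤ (1 + d) * (M * x) :=
    h5.trans (by gcongr; exact h6.trans (by gcongr))
  have h22 : L * ϖ (ω u t) ≤ L * (κ / 2 * x) := by gcongr
  have htri : ‖iterComp (stepMap φ τ) (i + k + 1) m B - φ t r a‖ ≤
      ‖iterComp (stepMap φ τ) (i + k + 1) m B - φ t u B‖ +
      ‖φ t u B - φ t u (φ u s (φ s r a))‖ +
      ‖φ t u (φ u s (φ s r a)) - φ t u (φ u r a)‖ + ‖φ t u (φ u r a) - φ t r a‖ := by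
    refine le_trans (le_of_eq ?_) (norm_add₄_le ..)
    congr 1; abel
  have hfin : κ / 2 * L + (1 + d) * ((1 + d) * (κ / 2 * L)) + (1 + d) * M + M ≤ L := by
    have : (1 + d) * (1 + d) ≤ 1 + 3 * ((1 - κ) / 10) := by nlinarith
    have h9 : (1 + d) * (1 + d) * (κ / 2 * L) ≤ (1 + 3 * ((1 - κ) / 10)) * (κ / 2 * L) := by
      gcongr
    have h10 : d * M ≤ 1 * M := by gcongr; linarith
    have h11 : κ * (L * (1 - κ)) ≤ 1 * (L * (1 - κ)) :=
      mul_le_mul_of_nonneg_right hκ1.le (mul_nonneg hL0 (by linarith))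
    linarith
  have := mul_le_mul_of_nonneg_right hfin hx
  linarith

set_option maxHeartbeats 800000 in
-- A difference of differences does not pass through a map that is merely Lipschitz; the 4-points
-- control carries it, at a cost proportional to `H`. Its smallness condition is supplied by the sup
-- bound of `norm_iterComp_sub_le`.
theorem lip_iterComp_sub (h : UniformStable T d M C α H ϖ ω φ) (hω : IsControl T ω)
    (hϖ : IsRemainder ϖ) {κ L K : ℝ} (hκ0 : 0 < κ) (hκ1 : κ < 1)
    (hκ : ∀ x y, 0 ≤ x → 0 ≤ y → x ≤ y / 2 → ϖ x ≤ κ / 2 * ϖ y)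
    (hd0 : 0 ≤ d) (hd : d ≤ (1 - κ) / 10) (hM : 0 ≤ M) (hC : 0 ≤ C) (hH : 0 ≤ H)
    (hL : 6 * M ≤ L * (1 - κ)) (hα : α = 2 * L + M)
    (hK : 2 * (12 * H + 3 * C) ≤ K * (1 - κ)) (hKT : K * ϖ (ω 0 T) ≤ (1 - κ) / 10)
    {τ : ℕ → ℝ} (hτ : Monotone τ) (hτT : ∀ i, τ i ∈ Icc 0 T) (i n : ℕ) (a b : V) :
    ‖(iterComp (stepMap φ τ) i n a - φ (τ (i + n)) (τ i) a) -
      (iterComp (stepMap φ τ) i n b - φ (τ (i + n)) (τ i) b)‖ ≤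
      K * ϖ (ω (τ i) (τ (i + n))) * ‖a - b‖ := by
  have hL0 : 0 ≤ L := by nlinarith
  have hK0 : 0 ≤ K := by nlinarith
  induction n using Nat.strong_induction_on generalizing i a b with
  | _ n ih =>
  rcases n with _ | n
  · simp [iterComp, h.refl _ (hτT i), hω.diag _ (hτT i), hϖ.zero]
  obtain ⟨k, m, hn, hk, hm⟩ := hω.exists_split hτ hτT i n
  have e1 : i + k + 1 + m = i + (n + 1) := by omega
  have ihk := ih k (by omega) i a b
  have supk := h.norm_iterComp_sub_le hω hϖ hκ0 hκ1 hκ hd0 hd hM hL hτ hτT i k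
  have supa := supk a
  have supb := supk b
  set A := iterComp (stepMap φ τ) i k a with hA
  set B := iterComp (stepMap φ τ) i k b with hB
  have ihm := ih m (by omega) (i + k + 1) (φ (τ (i + k + 1)) (τ (i + k)) A)
    (φ (τ (i + k + 1)) (τ (i + k)) B)
  have hcomp : ∀ a, iterComp (stepMap φ τ) i (n + 1) a = iterComp (stepMap φ τ) (i + k + 1) m
      (φ (τ (i + k + 1)) (τ (i + k)) (iterComp (stepMap φ τ) i k a)) := by
    intro a; rw [hn, iterComp_add]; rfl
  rw [hcomp a, hcomp b]
  rw [e1] at ihm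
  have hr0 := (hτT i).1
  have hrs : τ i ≤ τ (i + k) := hτ (by omega)
  have hss : τ (i + k) ≤ τ (i + k + 1) := hτ (by omega)
  have hst : τ (i + k + 1) ≤ τ (i + (n + 1)) := hτ (by omega)
  have htT := (hτT (i + (n + 1))).2
  rw [← hA, ← hB]
  generalize τ i = r at *
  generalize τ (i + k) = s at *
  generalize τ (i + k + 1) = u at *
  generalize τ (i + (n + 1)) = t at *
  have hu0 : 0 ≤ u := by linarith
  have hs0 : 0 ≤ s := by linarith
  have huT : u ≤ T := by linarith
  have hsT : s ≤ T := by linarith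
  have hru : r ≤ u := by linarith
  have hW := hω.nonneg r t hr0 (by linarith) htT
  have hx := hϖ.nonneg _ hW
  have h1 := hκ _ _ (hω.nonneg r s hr0 hrs hsT) hW hk
  have h2 := hκ _ _ (hω.nonneg u t hu0 hst htT) hW hm
  have h1' : ϖ (ω r s) ≤ ϖ (ω r t) :=
    hϖ.mono (hω.nonneg r s hr0 hrs hsT) hW (hω.mono hr0 le_rfl hrs (by linarith) htT)
  have h8 : ϖ (ω r u) ≤ ϖ (ω r t) :=
    hϖ.mono (hω.nonneg r u hr0 hru huT) hW (hω.mono hr0 le_rfl hru hst htT)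
  have hxT : K * ϖ (ω r t) ≤ (1 - κ) / 10 := by
    refine le_trans ?_ hKT
    gcongr
    exact hϖ.mono hW (hW.trans (hω.mono le_rfl hr0 (by linarith) htT le_rfl))
      (hω.mono le_rfl hr0 (by linarith) htT le_rfl)
  have l1 := h.lip r s hr0 hrs hsT a b
  have l2 := h.lip s u hs0 hss huT A B
  have l3 := h.lip s u hs0 hss huT (φ s r a) (φ s r b)
  have l4 := h.lip s u hs0 hss huT A (φ s r a)
  have l5 := h.lip s u hs0 hss huT B (φ s r b)
  have l6 := h.lip r u hr0 hru huT a b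
  have al1 := h.almost r s u hr0 hrs hss huT a
  have al2 := h.almost r s u hr0 hrs hss huT b
  have al3 := h.almost_lip r s u hr0 hrs hss huT a b
  have al4 := h.almost_lip r u t hr0 hru hst htT a b
  have f1 := h.four r s u t hr0 hrs hss hst htT A (φ s r a) B (φ s r b)
  have f2 := h.four r u t t hr0 hru hst le_rfl htT (φ u s A) (φ u s (φ s r a)) (φ u s B)
    (φ u s (φ s r b))
  have f3 := h.four r u t t hr0 hru hst le_rfl htT (φ u s (φ s r a)) (φ u r a)
    (φ u s (φ s r b)) (φ u r b)
  set x := ϖ (ω r t)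
  set N := ‖a - b‖ with hN
  have hN0 : 0 ≤ N := norm_nonneg _
  have hd2 : 1 + d ≤ 2 := by linarith
  -- The smallness of `K * ϖ (ω 0 T)` keeps the Lipschitz constant of the left block close to `1`,
  -- so the induction does not degrade.
  have hAB : ‖A - B‖ ≤ (1 + d + (1 - κ) / 10) * N := by
    have e : A - B = (A - φ s r a - (B - φ s r b)) + (φ s r a - φ s r b) := by abel
    rw [e]
    refine (norm_add_le _ _).trans ?_
    have : K * ϖ (ω r s) * N ≤ (1 - κ) / 10 * N := by
      gcongr; exact le_trans (by gcongr) hxT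
    linarith
  have hAB2 : ‖A - B‖ ≤ 2 * N := hAB.trans (by gcongr; linarith)
  have l1' : ‖φ s r a - φ s r b‖ ≤ 2 * N := l1.trans (by gcongr)
  have l6' : ‖φ u r a - φ u r b‖ ≤ 4 * N := l6.trans (by gcongr; linarith)
  have l2' : ‖φ u s A - φ u s B‖ ≤ 4 * N :=
    l2.trans ((mul_le_mul hd2 hAB2 (norm_nonneg _) (by norm_num)).trans (by linarith))
  have l3' : ‖φ u s (φ s r a) - φ u s (φ s r b)‖ ≤ 4 * N :=
    l3.trans ((mul_le_mul hd2 l1' (norm_nonneg _) (by norm_num)).trans (by linarith))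
  have hLx : 0 ≤ L * x := mul_nonneg hL0 hx
  have hMx : 0 ≤ M * x := mul_nonneg hM hx
  have ha1 : ‖A - φ s r a‖ ≤ L * x := supa.trans (by gcongr)
  have hb1 : ‖B - φ s r b‖ ≤ L * x := supb.trans (by gcongr)
  -- `α` covers the three gaps fed to `four`: `L * x`, its image under one map, at most `2 * L * x`,
  -- and a defect `M * x`.
  have hαx : α * x = 2 * (L * x) + M * x := by rw [hα]; ring
  have f1' := f1 (by linarith) (by linarith)
  have f2' := f2
    (by have := l4.trans (mul_le_mul hd2 ha1 (norm_nonneg _) (by norm_num)); linarith)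
    (by have := l5.trans (mul_le_mul hd2 hb1 (norm_nonneg _) (by norm_num)); linarith)
  have hMu : M * ϖ (ω r u) ≤ M * x := by gcongr
  have f3' := f3 (by linarith) (by linarith)
  have hHx : 0 ≤ H * x := mul_nonneg hH hx
  have m1 := mul_le_mul_of_nonneg_left (max_le hAB2 l1') hHx
  have m2 := mul_le_mul_of_nonneg_left (max_le l2' l3') hHx
  have m3 := mul_le_mul_of_nonneg_left (max_le l3' l6') hHx
  have c1 : ‖A - φ s r a - B + φ s r b‖ ≤ K * (κ / 2 * x) * N := by
    rw [show A - φ s r a - B + φ s r b = A - φ s r a - (B - φ s r b) by abel]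
    exact ihk.trans (by gcongr)
  have c3 : ‖φ u s (φ s r a) - φ u r a - φ u s (φ s r b) + φ u r b‖ ≤ C * x * N := by
    rw [show φ u s (φ s r a) - φ u r a - φ u s (φ s r b) + φ u r b =
      φ u s (φ s r a) - φ u r a - (φ u s (φ s r b) - φ u r b) by abel]
    exact al3.trans (by gcongr)
  have hHxN : 0 ≤ H * x * N := mul_nonneg hHx hN0
  have hCxN : 0 ≤ C * x * N := mul_nonneg (mul_nonneg hC hx) hN0
  have hKxN : 0 ≤ K * x * N := mul_nonneg (mul_nonneg hK0 hx) hN0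
  have d1 : (1 + d) * ‖A - φ s r a - B + φ s r b‖ ≤ (1 + d) * (K * (κ / 2 * x) * N) := by
    gcongr
  have d2 : (1 + d) * ‖φ u s A - φ u s (φ s r a) - φ u s B + φ u s (φ s r b)‖ ≤
      (1 + d) * (H * x * (2 * N) + (1 + d) * (K * (κ / 2 * x) * N)) := by
    refine mul_le_mul_of_nonneg_left ?_ (by linarith only [hd0])
    linarith only [f1', m1, d1]
  have d2' : d * (H * x * N) ≤ 1 * (H * x * N) := by gcongr; linarith
  have d3 : (1 + d) * ‖φ u s (φ s r a) - φ u r a - φ u s (φ s r b) + φ u r b‖ ≤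
      2 * (C * x * N) := mul_le_mul hd2 c3 (norm_nonneg _) (by norm_num)
  have t1 : ‖iterComp (stepMap φ τ) (i + k + 1) m (φ u s A) - φ t u (φ u s A) -
      (iterComp (stepMap φ τ) (i + k + 1) m (φ u s B) - φ t u (φ u s B))‖ ≤
      K * (κ / 2 * x) * ((1 + d) * ((1 + d + (1 - κ) / 10) * N)) := by
    refine ihm.trans ?_
    gcongr
    exact l2.trans (by gcongr)
  have htri : ‖iterComp (stepMap φ τ) (i + k + 1) m (φ u s A) - φ t r a -
      (iterComp (stepMap φ τ) (i + k + 1) m (φ u s B) - φ t r b)‖ ≤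
      ‖iterComp (stepMap φ τ) (i + k + 1) m (φ u s A) - φ t u (φ u s A) -
        (iterComp (stepMap φ τ) (i + k + 1) m (φ u s B) - φ t u (φ u s B))‖ +
      ‖φ t u (φ u s A) - φ t u (φ u s (φ s r a)) - φ t u (φ u s B) +
        φ t u (φ u s (φ s r b))‖ +
      ‖φ t u (φ u s (φ s r a)) - φ t u (φ u r a) - φ t u (φ u s (φ s r b)) +
        φ t u (φ u r b)‖ +
      ‖(φ t u (φ u r a) - φ t r a) - (φ t u (φ u r b) - φ t r b)‖ :=
    norm_sub_sub_sub_le_add₄ ..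
  -- `12 * H` collects `4` from each use of `four`, and `3 * C` is `2` from the transported defect
  -- plus `1`. The factor `2` in `hK` matches the slack `(1 - κ) / 2`.
  have hfin := contraction_factor_le hκ0 hκ1 hd0 hd
  have g1 := mul_le_mul_of_nonneg_right hfin hKxN
  have g2 := mul_le_mul_of_nonneg_right hK (mul_nonneg hx hN0)
  linarith only [htri, t1, f2', f3', m2, m3, d2, d2', d3, al4, g1, g2, hHxN, hCxN, hKxN]

end UniformStable

/-! ### Dyadic grids -/

/-- The dyadic grid of `[0,T]` of level `n`, clamped to `[s,t]`. -/
noncomputable def clampGrid (T s t : ℝ) (n i : ℕ) : ℝ := max s (min t (i * (T / 2 ^ n)))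

theorem clampGrid_monotone {T : ℝ} (hT : 0 ≤ T) (s t : ℝ) (n : ℕ) :
    Monotone (clampGrid T s t n) := by
  intro i j hij
  unfold clampGrid
  gcongr

theorem clampGrid_mem {T s t : ℝ} (hs : 0 ≤ s) (hst : s ≤ t) (ht : t ≤ T) (n i : ℕ) :
    clampGrid T s t n i ∈ Icc 0 T :=
  ⟨hs.trans (le_max_left _ _), max_le (hst.trans ht) ((min_le_left _ _).trans ht)⟩

theorem clampGrid_zero {T s t : ℝ} (hs : 0 ≤ s) (n : ℕ) : clampGrid T s t n 0 = s := by
  simp [clampGrid, hs]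

theorem clampGrid_last {T s t : ℝ} (hst : s ≤ t) (ht : t ≤ T) (n : ℕ) :
    clampGrid T s t n (2 ^ n) = t := by
  have : ((2 ^ n : ℕ) : ℝ) * (T / 2 ^ n) = T := by push_cast; field_simp
  rw [clampGrid, this, min_eq_left ht, max_eq_right hst]

theorem clampGrid_succ_sub_le {T : ℝ} (hT : 0 ≤ T) (s t : ℝ) (n i : ℕ) :
    clampGrid T s t n (i + 1) - clampGrid T s t n i ≤ T / 2 ^ n := by
  have h : 0 ≤ T / 2 ^ n := by positivity
  unfold clampGrid
  push_cast
  generalize T / 2 ^ n = y at *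
  have h1 : min t ((i + 1) * y) ≤ min t (i * y) + y := by
    rw [← min_add_add_right]
    exact min_le_min (by linarith) (by linarith)
  have h2 : max s (min t ((i + 1) * y)) ≤ max s (min t (i * y)) + y := by
    rw [← max_add_add_right]
    exact max_le_max (by linarith) h1
  linarith

theorem clampGrid_refine (T s t : ℝ) {n m : ℕ} (hnm : n ≤ m) (i : ℕ) :
    clampGrid T s t m (2 ^ (m - n) * i) = clampGrid T s t n i := by
  have h : (2 : ℝ) ^ m = 2 ^ (m - n) * 2 ^ n := by rw [← pow_add]; congr 1; omega
  unfold clampGrid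
  push_cast
  rw [h]
  congr 2
  field_simp

/-- Since all intervals share one grid, truncating the grid of `[r,t]` at `s` gives those of `[r,s]`
and `[s,t]` with the same indices, and compositions can be compared step by step. -/
theorem min_clampGrid {T r s t : ℝ} (hrs : r ≤ s) (hst : s ≤ t) (n i : ℕ) :
    min s (clampGrid T r t n i) = clampGrid T r s n i := by
  unfold clampGrid
  rw [min_max_distrib_left, ← min_assoc, min_eq_left hst, min_eq_right hrs]

theorem max_clampGrid {T r s t : ℝ} (hrs : r ≤ s) (n i : ℕ) :
    max s (clampGrid T r t n i) = clampGrid T s t n i := by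
  unfold clampGrid
  rw [← max_assoc, max_eq_left hrs]

theorem exists_forall_sum_clampGrid_le {T : ℝ} (hT : 0 ≤ T) {ω : ℝ → ℝ → ℝ}
    (hω : IsControl T ω) {ϖ : ℝ → ℝ} (hϖ : IsRemainder ϖ) {e : ℝ} (he : 0 < e) :
    ∃ N : ℕ, ∀ n, N ≤ n → ∀ s t, 0 ≤ s → s ≤ t → t ≤ T →
      ∑ i ∈ Finset.range (2 ^ n),
        ϖ (ω (clampGrid T s t n i) (clampGrid T s t n (i + 1))) ≤ e := by
  obtain ⟨η, hη, H⟩ := exists_sum_remainder_le hT hω hϖ he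
  have hlim : Tendsto (fun n : ℕ => T / 2 ^ n) atTop (𝓝 0) := by
    have := (tendsto_pow_atTop_nhds_zero_of_lt_one (r := (1 / 2 : ℝ)) (by norm_num)
      (by norm_num)).const_mul T
    rw [mul_zero] at this
    refine this.congr fun n => ?_
    rw [one_div, inv_pow, div_eq_mul_inv]
  obtain ⟨N, hN⟩ := eventually_atTop.1 (hlim.eventually (gt_mem_nhds hη))
  refine ⟨N, fun n hn s t hs hst ht => H _ _ (clampGrid_monotone hT s t n)
    (clampGrid_mem hs hst ht n) fun i => ?_⟩
  exact (clampGrid_succ_sub_le hT s t n i).trans_lt (hN n hn)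

/-! ### Perturbations of the identity by a contraction -/

section Contraction

variable {V : Type*} [NormedAddCommGroup V] {g : V → V} {k : ℝ}

theorem norm_sub_le_of_sub_id_lip (hg : ∀ a b, ‖(g a - a) - (g b - b)‖ ≤ k * ‖a - b‖) (a b : V) :
    ‖g a - g b‖ ≤ (1 + k) * ‖a - b‖ := by
  have h1 := hg a b
  have h2 := norm_add_le ((g a - a) - (g b - b)) (a - b)
  rw [show (g a - a) - (g b - b) + (a - b) = g a - g b by abel] at h2
  linarith

theorem norm_le_of_sub_id_lip (hg : ∀ a b, ‖(g a - a) - (g b - b)‖ ≤ k * ‖a - b‖) (hk : k < 1)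
    (a b : V) : ‖a - b‖ ≤ 1 / (1 - k) * ‖g a - g b‖ := by
  have h1 := hg a b
  have h2 := norm_sub_le (g a - g b) ((g a - a) - (g b - b))
  rw [show g a - g b - ((g a - a) - (g b - b)) = a - b by abel] at h2
  have : 0 < 1 - k := by linarith
  rw [div_mul_eq_mul_div, le_div_iff₀ this]
  linarith

/-- A preimage of `y` is the fixed point of the contraction `x ↦ y - (g x - x)`. -/
theorem bijective_of_sub_id_lip [CompleteSpace V]
    (hg : ∀ a b, ‖(g a - a) - (g b - b)‖ ≤ k * ‖a - b‖) (hk0 : 0 ≤ k) (hk : k < 1) :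
    Function.Bijective g := by
  refine ⟨fun a b hab => ?_, fun y => ?_⟩
  · have := norm_le_of_sub_id_lip hg hk a b
    rw [hab, sub_self, norm_zero, mul_zero] at this
    exact sub_eq_zero.1 (norm_le_zero_iff.1 this)
  · have hc : ContractingWith ⟨k, hk0⟩ (fun x => y - (g x - x)) := by
      refine ⟨by exact_mod_cast hk, LipschitzWith.of_dist_le_mul fun a b => ?_⟩
      rw [dist_eq_norm, dist_eq_norm,
        show y - (g a - a) - (y - (g b - b)) = -((g a - a) - (g b - b)) by abel, norm_neg]
      exact hg a b
    refine ⟨hc.fixedPoint, ?_⟩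
    have := hc.fixedPoint_isFixedPt
    unfold Function.IsFixedPt at this
    have h2 : y - g hc.fixedPoint = 0 := by
      have h3 : y - (g hc.fixedPoint - hc.fixedPoint) - hc.fixedPoint = 0 := sub_eq_zero.2 this
      rwa [show y - (g hc.fixedPoint - hc.fixedPoint) - hc.fixedPoint = y - g hc.fixedPoint by
        abel] at h3
    exact (sub_eq_zero.1 h2).symm

theorem continuous_of_norm_sub_le {c : ℝ} (hg : ∀ a b, ‖g a - g b‖ ≤ c * ‖a - b‖) :
    Continuous g := by
  refine (LipschitzWith.of_dist_le_mul (K := c.toNNReal) fun a b => ?_).continuous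
  rw [dist_eq_norm, dist_eq_norm]
  exact (hg a b).trans (by gcongr; exact Real.le_coe_toNNReal c)

end Contraction

/-! ### Sewing -/

section Sewing

variable {V : Type*} {T : ℝ} {ϖ : ℝ → ℝ} {ω : ℝ → ℝ → ℝ} {φ : ℝ → ℝ → V → V}

/-- Up to `s` the `max` steps are the identity, and beyond `s` the `min` steps are, so the
interleaved factors separate. -/
theorem iterComp_stepMap_min_max (hrefl : ∀ t ∈ Icc 0 T, φ t t = id) {τ : ℕ → ℝ}
    (hτ : Monotone τ) {s : ℝ} (hs : s ∈ Icc 0 T) (i n : ℕ) :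
    iterComp (fun j => stepMap φ (fun l => max s (τ l)) j ∘ stepMap φ (fun l => min s (τ l)) j)
      i n = iterComp (stepMap φ fun l => max s (τ l)) i n ∘
        iterComp (stepMap φ fun l => min s (τ l)) i n := by
  induction n generalizing i with
  | zero => rfl
  | succ n ih =>
    simp only [iterComp]
    rw [ih]
    rcases le_total (τ (i + 1)) s with h | h
    · have : stepMap φ (fun l => max s (τ l)) i = id := by
        simp only [stepMap]
        rw [max_eq_left h, max_eq_left ((hτ (Nat.le_succ i)).trans h), hrefl s hs]
      rw [this]; rfl
    · have : iterComp (stepMap φ fun l => min s (τ l)) (i + 1) n = id := by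
        refine iterComp_eq_id _ _ _ fun j hj => ?_
        simp only [stepMap]
        rw [min_eq_left (h.trans (hτ hj)), min_eq_left (h.trans (hτ (by omega))), hrefl s hs]
      rw [this]; rfl

theorem iterComp_stepMap_of_comp {ψ : ℝ → ℝ → V → V} (hrefl : ∀ t ∈ Icc 0 T, ψ t t = id)
    (hcomp : ∀ r s t, 0 ≤ r → r ≤ s → s ≤ t → t ≤ T → ψ t s ∘ ψ s r = ψ t r) {τ : ℕ → ℝ}
    (hτ : Monotone τ) (hτT : ∀ i, τ i ∈ Icc 0 T) (i n : ℕ) :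
    iterComp (stepMap ψ τ) i n = ψ (τ (i + n)) (τ i) := by
  induction n generalizing i with
  | zero => rw [iterComp, add_zero, hrefl _ (hτT i)]
  | succ n ih =>
    rw [iterComp, ih, stepMap, hcomp _ _ _ (hτT i).1 (hτ (by omega)) (hτ (by omega)) (hτT _).2,
      show i + 1 + n = i + (n + 1) by omega]

theorem IsFlow.symm_apply {ψ : ℝ → ℝ → V → V} (h : IsFlow T ψ) {s t : ℝ} (hs : s ∈ Icc 0 T)
    (ht : t ∈ Icc 0 T) (a : V) : ψ s t (ψ t s a) = a := by
  rcases le_total s t with hst | hst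
  · exact congrFun (h.inv s hs t ht hst).1 a
  · exact congrFun (h.inv t ht s hs hst).2 a

theorem exists_isFlow_of_comp [Nonempty V] {ψ : ℝ → ℝ → V → V} (hrefl : ∀ t ∈ Icc 0 T, ψ t t = id)
    (hcomp : ∀ r s t, 0 ≤ r → r ≤ s → s ≤ t → t ≤ T → ψ t s ∘ ψ s r = ψ t r)
    (hbij : ∀ s t, 0 ≤ s → s ≤ t → t ≤ T → Function.Bijective (ψ t s)) :
    ∃ θ : ℝ → ℝ → V → V, IsFlow T θ ∧ ∀ s t, s ≤ t → θ t s = ψ t s := by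
  classical
  set θ : ℝ → ℝ → V → V := fun t s => if s ≤ t then ψ t s else Function.invFun (ψ s t) with hθ
  have h1 : ∀ s t, s ≤ t → θ t s = ψ t s := fun s t h => if_pos h
  have hinv : ∀ s ∈ Icc 0 T, ∀ t ∈ Icc 0 T, s ≤ t → θ s t ∘ θ t s = id ∧ θ t s ∘ θ s t = id := by
    intro s hs t ht hst
    rcases hst.eq_or_lt with rfl | hlt
    · rw [h1 s s le_rfl, hrefl s hs]; simp
    · have h2 : θ s t = Function.invFun (ψ t s) := if_neg (not_le.2 hlt)
      rw [h1 s t hst, h2]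
      have hb := hbij s t hs.1 hst ht.2
      exact ⟨Function.invFun_comp hb.1, funext (Function.rightInverse_invFun hb.2)⟩
  refine ⟨θ, ⟨fun t ht => (h1 t t le_rfl).trans (hrefl t ht), hinv, ?_⟩, h1⟩
  rintro r hr s hs t ht (⟨hrs, hst⟩ | ⟨hrs, hst⟩)
  · rw [h1 s t hst, h1 r s hrs, h1 r t (hrs.trans hst), hcomp r s t hr.1 hrs hst ht.2]
  · have hc := hcomp t s r ht.1 hst hrs hr.2
    rw [← h1 t r (hst.trans hrs), ← h1 t s hst, ← h1 s r hrs] at hc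
    funext a
    have e1 := fun x => congrFun (hinv t ht s hs hst).2 x
    have e2 := fun x => congrFun (hinv s hs r hr hrs).2 x
    have e3 := fun x => congrFun (hinv t ht r hr (hst.trans hrs)).1 x
    simp only [Function.comp_apply, id] at e1 e2 e3
    have h3 := e3 (θ t s (θ s r a))
    rw [← hc, Function.comp_apply, e1, e2] at h3
    exact h3.symm

variable [NormedAddCommGroup V]

/-- Only a step straddling `s` is changed, and there the error is one almost-flow defect. -/
theorem norm_stepMap_sub_min_max_le (hrefl : ∀ t ∈ Icc 0 T, φ t t = id) (hω : IsControl T ω)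
    (hϖ : IsRemainder ϖ) {M : ℝ} (hM : 0 ≤ M)
    (halmost : ∀ r s t, 0 ≤ r → r ≤ s → s ≤ t → t ≤ T → ∀ a,
      ‖φ t s (φ s r a) - φ t r a‖ ≤ M * ϖ (ω r t)) {τ : ℕ → ℝ}
    (hτ : Monotone τ) (hτT : ∀ i, τ i ∈ Icc 0 T) {s : ℝ} (hs : s ∈ Icc 0 T) (i : ℕ) (a : V) :
    ‖stepMap φ τ i a - (stepMap φ (fun l => max s (τ l)) i ∘
      stepMap φ (fun l => min s (τ l)) i) a‖ ≤ M * ϖ (ω (τ i) (τ (i + 1))) := by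
  have hii := hτ (Nat.le_succ i)
  have hnn := mul_nonneg hM (hϖ.nonneg _ (hω.nonneg _ _ (hτT i).1 hii (hτT (i + 1)).2))
  simp only [stepMap, Function.comp_apply]
  rcases le_total (τ (i + 1)) s with h | h
  · rw [max_eq_left h, max_eq_left (hii.trans h), hrefl s hs, min_eq_right h,
      min_eq_right (hii.trans h)]
    simpa using hnn
  rcases le_total s (τ i) with h' | h'
  · rw [max_eq_right h, max_eq_right h', min_eq_left h, min_eq_left h', hrefl s hs]
    simpa using hnn
  · rw [max_eq_right h, max_eq_left h', min_eq_left h, min_eq_right h', norm_sub_rev]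
    exact halmost _ _ _ (hτT i).1 h' h (hτT _).2 a

/-- Each coarse grid step is compared by `hbound` with the composition of the fine steps inside it,
which makes the dyadic compositions Cauchy. The bounds do not depend on the partition and pass to
the limit. -/
theorem exists_sewing [CompleteSpace V] (hT : 0 ≤ T) (hω : IsControl T ω) (hϖ : IsRemainder ϖ)
    (hrefl : ∀ t ∈ Icc 0 T, φ t t = id) {L M k : ℝ} (hL : 0 ≤ L) (hM : 0 ≤ M) (hk : 0 ≤ k)
    (halmost : ∀ r s t, 0 ≤ r → r ≤ s → s ≤ t → t ≤ T → ∀ a,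
      ‖φ t s (φ s r a) - φ t r a‖ ≤ M * ϖ (ω r t))
    (hbound : ∀ τ : ℕ → ℝ, Monotone τ → (∀ i, τ i ∈ Icc 0 T) → ∀ i n a,
      ‖iterComp (stepMap φ τ) i n a - φ (τ (i + n)) (τ i) a‖ ≤ L * ϖ (ω (τ i) (τ (i + n))))
    (hlip : ∀ τ : ℕ → ℝ, Monotone τ → (∀ i, τ i ∈ Icc 0 T) → ∀ i n a b,
      ‖(iterComp (stepMap φ τ) i n a - a) - (iterComp (stepMap φ τ) i n b - b)‖ ≤
        k * ‖a - b‖) :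
    ∃ ψ : ℝ → ℝ → V → V, (∀ t ∈ Icc 0 T, ψ t t = id) ∧
      (∀ r s t, 0 ≤ r → r ≤ s → s ≤ t → t ≤ T → ψ t s ∘ ψ s r = ψ t r) ∧
      (∀ s t, 0 ≤ s → s ≤ t → t ≤ T → ∀ a, ‖φ t s a - ψ t s a‖ ≤ L * ϖ (ω s t)) ∧
      (∀ s t, 0 ≤ s → s ≤ t → t ≤ T → ∀ a b,
        ‖(ψ t s a - a) - (ψ t s b - b)‖ ≤ k * ‖a - b‖) := by
  set P : ℕ → ℝ → ℝ → V → V := fun n t s =>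
    iterComp (stepMap φ (clampGrid T s t n)) 0 (2 ^ n) with hP
  have hmono := fun s t n => clampGrid_monotone hT s t n
  have hΛ : ∀ τ : ℕ → ℝ, Monotone τ → (∀ i, τ i ∈ Icc 0 T) → ∀ i n a b,
      ‖iterComp (stepMap φ τ) i n a - iterComp (stepMap φ τ) i n b‖ ≤ (1 + k) * ‖a - b‖ :=
    fun τ hτ hτT i n => norm_sub_le_of_sub_id_lip (hlip τ hτ hτT i n)
  have hrefine : ∀ s t, 0 ≤ s → s ≤ t → t ≤ T → ∀ a n m, n ≤ m → ‖P n t s a - P m t s a‖ ≤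
      (1 + k) * (L * ∑ i ∈ Finset.range (2 ^ n),
        ϖ (ω (clampGrid T s t n i) (clampGrid T s t n (i + 1)))) := by
    intro s t hs hst ht a n m hnm
    have hmem := clampGrid_mem (T := T) hs hst ht
    have h2 : 2 ^ m = 2 ^ (m - n) * 2 ^ n := by rw [← pow_add]; congr 1; omega
    have h3 : P m t s = iterComp (fun j => iterComp (stepMap φ (clampGrid T s t m))
        (2 ^ (m - n) * j) (2 ^ (m - n))) 0 (2 ^ n) := by
      rw [← iterComp_mul, ← h2, mul_zero]
    rw [h3, Finset.mul_sum]
    refine _root_.norm_iterComp_sub_le (by linarith) (hΛ _ (hmono s t n) (hmem n)) ?_ _ _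
    intro i a
    rw [norm_sub_rev]
    have := hbound _ (hmono s t m) (hmem m) (2 ^ (m - n) * i) (2 ^ (m - n)) a
    rwa [show 2 ^ (m - n) * i + 2 ^ (m - n) = 2 ^ (m - n) * (i + 1) by ring,
      clampGrid_refine T s t hnm, clampGrid_refine T s t hnm] at this
  have hcauchy : ∀ s t, 0 ≤ s → s ≤ t → t ≤ T → ∀ a, CauchySeq fun n => P n t s a := by
    intro s t hs hst ht a
    refine Metric.cauchySeq_iff'.2 fun e he => ?_
    obtain ⟨N, hN⟩ := exists_forall_sum_clampGrid_le hT hω hϖ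
      (e := e / ((1 + k) * (L + 1))) (by positivity)
    refine ⟨N, fun n hn => ?_⟩
    rw [dist_comm, dist_eq_norm]
    refine (hrefine s t hs hst ht a N n hn).trans_lt ?_
    calc _ ≤ (1 + k) * (L * (e / ((1 + k) * (L + 1)))) := by
          gcongr; exact hN N le_rfl s t hs hst ht
      _ = L / (L + 1) * e := by field_simp
      _ < 1 * e := by gcongr; rw [div_lt_one (by linarith)]; linarith
      _ = e := one_mul e
  have hlim : ∀ s t, 0 ≤ s → s ≤ t → t ≤ T → ∀ a, Tendsto (fun n => P n t s a) atTop
      (𝓝 (limUnder atTop fun n => P n t s a)) :=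
    fun s t hs hst ht a => (hcauchy s t hs hst ht a).tendsto_limUnder
  refine ⟨fun t s a => limUnder atTop fun n => P n t s a, ?_, ?_, ?_, ?_⟩
  · intro t ht
    funext a
    refine tendsto_nhds_unique (hlim t t ht.1 le_rfl ht.2 a) ?_
    refine tendsto_const_nhds.congr fun n => ?_
    rw [hP]
    have : ∀ i, clampGrid T t t n i = t := fun i => by simp [clampGrid]
    have h2 := iterComp_eq_id (stepMap φ (clampGrid T t t n)) 0 (2 ^ n) fun j _ => by
      rw [stepMap, this, this, hrefl t ht]
    simp [h2]
  · intro r s t hr hrs hst ht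
    funext a
    have hs : 0 ≤ s := hr.trans hrs
    have hrT : r ≤ t := hrs.trans hst
    have h1 : Tendsto (fun n => P n t s (P n s r a)) atTop
        (𝓝 (limUnder atTop fun n => P n t s (limUnder atTop fun n => P n s r a))) := by
      refine tendsto_of_tendsto_of_dist (hlim s t hs hst ht _) ?_
      have h2 := (tendsto_iff_norm_sub_tendsto_zero.1 (hlim r s hr hrs (hst.trans ht) a)).const_mul
        (1 + k)
      rw [mul_zero] at h2
      refine squeeze_zero (fun _ => dist_nonneg) (fun n => ?_) h2
      rw [dist_comm, dist_eq_norm]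
      exact hΛ _ (hmono s t n) (clampGrid_mem hs hst ht n) 0 (2 ^ n) _ _
    -- Composing over `[r,s]` and then `[s,t]` amounts to inserting `s` in the grid of `[r,t]`,
    -- which changes the result by an amount tending to `0`.
    refine tendsto_nhds_unique h1 ?_
    refine tendsto_of_tendsto_of_dist (hlim r t hr hrT ht a) ?_
    refine Metric.tendsto_atTop.2 fun e he => ?_
    obtain ⟨N, hN⟩ := exists_forall_sum_clampGrid_le hT hω hϖ
      (e := e / ((1 + k) * (M + 1))) (by positivity)
    refine ⟨N, fun n hn => ?_⟩
    rw [Real.dist_eq, sub_zero, abs_of_nonneg dist_nonneg, dist_eq_norm]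
    have hmem := clampGrid_mem (T := T) hr hrT ht n
    have h3 : P n t s (P n s r a) = iterComp (fun j =>
        stepMap φ (fun l => max s (clampGrid T r t n l)) j ∘
          stepMap φ (fun l => min s (clampGrid T r t n l)) j) 0 (2 ^ n) a := by
      rw [iterComp_stepMap_min_max hrefl (hmono r t n) ⟨hs, hst.trans ht⟩]
      simp only [hP, min_clampGrid hrs hst, max_clampGrid hrs]
      rfl
    have h4 := _root_.norm_iterComp_sub_le (by linarith) (hΛ _ (hmono r t n) hmem)
      (norm_stepMap_sub_min_max_le hrefl hω hϖ hM halmost (hmono r t n) hmem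
        ⟨hs, hst.trans ht⟩) (2 ^ n) a
    rw [h3]
    refine h4.trans_lt ?_
    rw [← Finset.mul_sum]
    calc _ ≤ (1 + k) * (M * (e / ((1 + k) * (M + 1)))) := by
          gcongr; exact hN n hn r t hr hrT ht
      _ = M / (M + 1) * e := by field_simp
      _ < 1 * e := by gcongr; rw [div_lt_one (by linarith)]; linarith
      _ = e := one_mul e
  · intro s t hs hst ht a
    refine le_of_tendsto (tendsto_const_nhds.sub (hlim s t hs hst ht a)).norm ?_
    refine Eventually.of_forall fun n => ?_
    have := hbound _ (hmono s t n) (clampGrid_mem hs hst ht n) 0 (2 ^ n) a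
    rw [zero_add, clampGrid_zero hs, clampGrid_last hst ht] at this
    rw [norm_sub_rev]
    exact this
  · intro s t hs hst ht a b
    refine le_of_tendsto (((hlim s t hs hst ht a).sub_const a).sub
      ((hlim s t hs hst ht b).sub_const b)).norm ?_
    exact Eventually.of_forall fun n =>
      hlip _ (hmono s t n) (clampGrid_mem hs hst ht n) 0 (2 ^ n) a b

/-- A flow equals its composition along every grid, so telescoping bounds the distance by `Λ * |C|`
times a sum of remainders that is arbitrarily small. Only `ψ` has to be Lipschitz. -/
theorem IsFlow.eq_of_norm_sub_le {ψ θ : ℝ → ℝ → V → V} (hT : 0 ≤ T) (hω : IsControl T ω)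
    (hϖ : IsRemainder ϖ) (hψ : IsFlow T ψ) (hθ : IsFlow T θ) {Λ C : ℝ} (hΛ : 0 ≤ Λ)
    (hlip : ∀ s t, 0 ≤ s → s ≤ t → t ≤ T → ∀ a b, ‖ψ t s a - ψ t s b‖ ≤ Λ * ‖a - b‖)
    (hclose : ∀ s t, 0 ≤ s → s ≤ t → t ≤ T → ∀ a, ‖ψ t s a - θ t s a‖ ≤ C * ϖ (ω s t))
    {s t : ℝ} (hs : s ∈ Icc 0 T) (ht : t ∈ Icc 0 T) : θ t s = ψ t s := by
  have key : ∀ s t, 0 ≤ s → s ≤ t → t ≤ T → ∀ a, θ t s a = ψ t s a := by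
    intro s t hs hst ht a
    have hcψ : ∀ r s t, 0 ≤ r → r ≤ s → s ≤ t → t ≤ T → ψ t s ∘ ψ s r = ψ t r :=
      fun r s t hr hrs hst ht => hψ.comp r ⟨hr, by linarith⟩ s ⟨by linarith, by linarith⟩ t
        ⟨by linarith, ht⟩ (Or.inl ⟨hrs, hst⟩)
    have hcθ : ∀ r s t, 0 ≤ r → r ≤ s → s ≤ t → t ≤ T → θ t s ∘ θ s r = θ t r :=
      fun r s t hr hrs hst ht => hθ.comp r ⟨hr, by linarith⟩ s ⟨by linarith, by linarith⟩ t
        ⟨by linarith, ht⟩ (Or.inl ⟨hrs, hst⟩)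
    have hle : ∀ e : ℝ, 0 < e → ‖ψ t s a - θ t s a‖ ≤ (Λ * |C|) * e := by
      intro e he
      obtain ⟨N, hN⟩ := exists_forall_sum_clampGrid_le hT hω hϖ he
      have hmono := clampGrid_monotone hT s t N
      have hmem := clampGrid_mem (T := T) hs hst ht N
      have h1 := norm_iterComp_sub_le (f := stepMap ψ (clampGrid T s t N))
        (g := stepMap θ (clampGrid T s t N)) (Λ := Λ)
        (e := fun i => |C| * ϖ (ω (clampGrid T s t N i) (clampGrid T s t N (i + 1)))) hΛ
        (fun i n a b => by
          rw [iterComp_stepMap_of_comp hψ.refl hcψ hmono hmem]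
          exact hlip _ _ (hmem _).1 (hmono (by omega)) (hmem _).2 a b)
        (fun i a => (hclose _ _ (hmem i).1 (hmono (Nat.le_succ i)) (hmem _).2 a).trans
          (mul_le_mul_of_nonneg_right (le_abs_self C)
            (hϖ.nonneg _ (hω.nonneg _ _ (hmem i).1 (hmono (Nat.le_succ i)) (hmem _).2))))
        (2 ^ N) a
      rw [iterComp_stepMap_of_comp hψ.refl hcψ hmono hmem,
        iterComp_stepMap_of_comp hθ.refl hcθ hmono hmem, zero_add, clampGrid_zero hs,
        clampGrid_last hst ht, ← Finset.mul_sum, ← mul_assoc] at h1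
      refine h1.trans ?_
      gcongr
      exact hN N le_rfl s t hs hst ht
    have h0 : ‖ψ t s a - θ t s a‖ ≤ 0 := by
      have hlim : Tendsto (fun e : ℝ => (Λ * |C|) * e) (𝓝[>] 0) (𝓝 0) := by
        have := (continuous_const_mul (Λ * |C|)).tendsto 0
        rw [mul_zero] at this
        exact this.mono_left nhdsWithin_le_nhds
      exact ge_of_tendsto hlim (by filter_upwards [self_mem_nhdsWithin] with e he using hle e he)
    exact (sub_eq_zero.1 (norm_le_zero_iff.1 h0)).symm
  funext a
  rcases le_total s t with hst | hst
  · exact key s t hs.1 hst ht.2 a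
  · have h1 := key t s ht.1 hst hs.2 (ψ t s a)
    rw [hψ.symm_apply hs ht] at h1
    have h2 := hθ.symm_apply ht hs (ψ t s a)
    rw [h1] at h2
    exact h2

end Sewing

/-! ### Inverses of stable almost flows -/

section Inverse

variable {V : Type*} [NormedAddCommGroup V]

theorem ctrl_of_le {ω : ℝ → ℝ → ℝ} {s t : ℝ} (h : s ≤ t) : ctrl ω s t = ω s t := by
  rw [ctrl, min_eq_left h, max_eq_right h]

theorem ctrl_of_ge {ω : ℝ → ℝ → ℝ} {s t : ℝ} (h : t ≤ s) : ctrl ω s t = ω t s := by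
  rw [ctrl, min_eq_right h, max_eq_left h]

/-- With `id = g - (g - id)`, the term in `c - 1` is absorbed on the left, leaving `2 - c`. A
control of `g` alone, with constant near `1`, would not allow this. -/
theorem FourPointsControl.norm_le_of_sub_id {g : V → V} {hat : ℝ → ℝ} {c : ℝ}
    (h : FourPointsControl (fun a => g a - a) hat (c - 1)) (hc : c < 2) (x y z w : V) :
    ‖x - y - z + w‖ ≤ 1 / (2 - c) * (‖g x - g y - g z + g w‖ +
      hat (max ‖x - y‖ ‖z - w‖) * max ‖x - z‖ ‖y - w‖) := by
  have h1 := h.bound x y z w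
  have h2 := norm_sub_le (g x - g y - g z + g w) (g x - x - (g y - y) - (g z - z) + (g w - w))
  rw [show g x - g y - g z + g w - (g x - x - (g y - y) - (g z - z) + (g w - w)) =
    x - y - z + w by abel] at h2
  have : 0 < 2 - c := by linarith
  rw [div_mul_eq_mul_div, le_div_iff₀ this]
  linarith

variable [CompleteSpace V] {T₀ T : ℝ} {ω : ℝ → ℝ → ℝ} {ϖ δ : ℝ → ℝ}
  {φ : ℝ → ℝ → V → V} {hat : ℝ → ℝ → ℝ → ℝ} {check : ℝ → ℝ → ℝ}

theorem IsStableAlmostFlowWith.reverse (hω : IsControl T₀ ω) (hϖ : IsRemainder ϖ)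
    (hδ : IsModulus δ) (hφ : IsStableAlmostFlowWith T₀ δ ϖ ω φ hat check)
    (hχ : ∀ s ∈ Icc 0 T₀, ∀ t ∈ Icc 0 T₀, s ≤ t →
      FourPointsControl (fun a => φ t s a - a) (hat t s) (check t s - 1))
    (hχ_lip : ∀ T ∈ Ioc 0 T₀, ∀ s ∈ Icc 0 T, ∀ t ∈ Icc 0 T, s ≤ t →
      ∀ a b, ‖(φ t s a - a) - (φ t s b - b)‖ ≤ δ T * ‖a - b‖)
    (hT : T ∈ Ioc 0 T₀) (hδT : δ T < 1) :
    IsReverseStableAlmostFlow T (fun u => δ u / (1 - δ u)) ϖ ω (invFamily φ) := by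
  have hδ0 := hδ.nonneg T hT.1.le
  have hinc : ∀ {s}, s ∈ Icc 0 T → s ∈ Icc 0 T₀ := fun hs => ⟨hs.1, hs.2.trans hT.2⟩
  have hU1 : ∀ {U}, U ∈ Ioc 0 T → 0 < 1 - δ U := fun {U} hU => by
    have := hδ.mono (mem_Ici.2 hU.1.le) (mem_Ici.2 hT.1.le) hU.2
    linarith
  have hδ' : ∀ {U}, U ∈ Ioc 0 T → 1 + δ U / (1 - δ U) = 1 / (1 - δ U) := fun {U} hU => by
    have := (hU1 hU).ne'
    field_simp
    ring
  have hbij : ∀ {s t}, s ∈ Icc 0 T → t ∈ Icc 0 T → s ≤ t → Function.Bijective (φ t s) :=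
    fun hs ht hst => bijective_of_sub_id_lip (hχ_lip T hT _ hs _ ht hst) hδ0 hδT
  have hright : ∀ {s t}, s ∈ Icc 0 T → t ∈ Icc 0 T → s ≤ t → ∀ a,
      φ t s (invFamily φ s t a) = a :=
    fun hs ht hst => Function.rightInverse_invFun (hbij hs ht hst).2
  have hlip : ∀ {U s t}, U ∈ Ioc 0 T → s ∈ Icc 0 U → t ∈ Icc 0 U → s ≤ t → ∀ a b,
      ‖invFamily φ s t a - invFamily φ s t b‖ ≤ 1 / (1 - δ U) * ‖a - b‖ := by
    intro U s t hU hs ht hst a b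
    have h1 := norm_le_of_sub_id_lip (hχ_lip U ⟨hU.1, hU.2.trans hT.2⟩ s hs t ht hst)
      (by linarith [hU1 hU]) (invFamily φ s t a) (invFamily φ s t b)
    rwa [hright ⟨hs.1, hs.2.trans hU.2⟩ ⟨ht.1, ht.2.trans hU.2⟩ hst,
      hright ⟨hs.1, hs.2.trans hU.2⟩ ⟨ht.1, ht.2.trans hU.2⟩ hst] at h1
  have hTT : T ∈ Ioc 0 T := ⟨hT.1, le_rfl⟩
  set q := 1 / (1 - δ T) with hq
  have hq1 : 1 ≤ q := by
    rw [hq, le_div_iff₀ (hU1 hTT)]; linarith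
  have hq0 : 0 ≤ q := by linarith
  have hcheck2 : ∀ {U s t}, U ∈ Ioc 0 T → s ∈ Icc 0 U → t ∈ Icc 0 U → s ≤ t →
      1 - δ U ≤ 2 - check t s := fun {U s t} hU hs ht hst => by
    linarith [hφ.check_le U ⟨hU.1, hU.2.trans hT.2⟩ s hs t ht hst]
  have hcq : ∀ {U s t}, U ∈ Ioc 0 T → s ∈ Icc 0 U → t ∈ Icc 0 U → s ≤ t →
      1 / (2 - check t s) ≤ 1 / (1 - δ U) := fun hU hs ht hst =>
    one_div_le_one_div_of_le (hU1 hU) (hcheck2 hU hs ht hst)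
  have hcpos : ∀ {s t}, s ∈ Icc 0 T → t ∈ Icc 0 T → s ≤ t → 0 < 2 - check t s :=
    fun hs ht hst => (hU1 hTT).trans_le (hcheck2 hTT hs ht hst)
  have hϖnn : ∀ {s t}, s ∈ Icc 0 T → t ∈ Icc 0 T → s ≤ t → 0 ≤ ϖ (ω s t) :=
    fun hs ht hst => hϖ.nonneg _ (hω.nonneg _ _ hs.1 hst (hinc ht).2)
  obtain ⟨M, hM, hMb⟩ := hφ.almostFlow.almost
  obtain ⟨C, hC, hCb⟩ := hφ.lip
  -- The argument `q * M` is the size of the almost-flow defect of the inverses, proved next.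
  obtain ⟨K, hK, hKb⟩ := hφ.fourPoints.compat (q * M) (by positivity)
  have halmost : ∀ r ∈ Icc 0 T, ∀ s ∈ Icc 0 T, ∀ t ∈ Icc 0 T, r ≥ s → s ≥ t → ∀ a,
      ‖invFamily φ t s (invFamily φ s r a) - invFamily φ t r a‖ ≤ q * M * ϖ (ω t r) := by
    intro r hr s hs t ht hrs hst a
    have h1 := norm_le_of_sub_id_lip (hχ_lip T hT t ht r hr (hst.le.trans hrs)) hδT
      (invFamily φ t s (invFamily φ s r a)) (invFamily φ t r a)
    have h2 := hMb t (hinc ht) s (hinc hs) r (hinc hr) hst hrs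
      (invFamily φ t s (invFamily φ s r a))
    rw [hright ht hs hst, hright hs hr hrs, ctrl_of_le (hst.le.trans hrs)] at h2
    rw [hright ht hr (hst.le.trans hrs), norm_sub_rev (φ r t _)] at h1
    rw [mul_assoc]
    exact h1.trans (by gcongr)
  -- In `q ^ 2`, one `q` bounds `1 / (2 - check)` and the other is the Lipschitz constant of the
  -- inverses, which also rescales the argument of `hat`. From `check ≤ 1 + δ U` follows `1 / (2 -
  -- check) ≤ 1 / (1 - δ U) = 1 + δ' U`.
  refine ⟨fun t s x => q ^ 2 * hat s t (q * x), fun t s => 1 / (2 - check s t),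
    ⟨?_, ?_, ?_, ?_, ⟨q * M, by positivity, ?_⟩⟩, ⟨?_, ?_, ?_⟩, ?_, ?_⟩
  · intro s hs t ht hst
    exact continuous_of_norm_sub_le (hlip hTT ht hs hst)
  · intro t ht
    funext a
    have h1 := hright ht ht le_rfl a
    rw [hφ.almostFlow.refl t (hinc ht)] at h1
    exact h1
  · intro U hU s hs t ht hst a
    have h1 := hφ.almostFlow.near_id U ⟨hU.1, hU.2.trans hT.2⟩ t ht s hs hst
      (invFamily φ t s a)
    rw [hright ⟨ht.1, ht.2.trans hU.2⟩ ⟨hs.1, hs.2.trans hU.2⟩ hst, norm_sub_rev] at h1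
    refine h1.trans ?_
    rw [le_div_iff₀ (hU1 hU)]
    nlinarith [hδ.nonneg U hU.1.le]
  · intro U hU s hs t ht hst a b
    rw [hδ' hU]
    simpa using hlip hU ht hs hst b a
  · intro r hr s hs t ht hrs hst a
    rw [ctrl_of_ge (hst.le.trans hrs)]
    exact halmost r hr s hs t ht hrs hst a
  · intro s hs t ht hst
    have hc := hφ.fourPoints.control t (hinc ht) s (hinc hs) hst
    have hmaps : MapsTo (fun x : ℝ => q * x) (Ici 0) (Ici 0) :=
      fun x hx => mul_nonneg hq0 (mem_Ici.1 hx)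
    refine ⟨fun x hx => mul_nonneg (by positivity) (hc.hat_nonneg _ (mul_nonneg hq0 hx)),
      fun x hx y hy hxy => ?_, ?_, (one_div_pos.2 (hcpos ht hs hst)).le, fun a b c e => ?_⟩
    · have := hc.hat_mono (hmaps hx) (hmaps hy) (mul_le_mul_of_nonneg_left hxy hq0)
      exact mul_le_mul_of_nonneg_left this (by positivity)
    · exact (hc.hat_cont.comp (by fun_prop) hmaps).const_mul (q ^ 2)
    · have h1 := (hχ t (hinc ht) s (hinc hs) hst).norm_le_of_sub_id
        (by linarith [hcpos ht hs hst]) (invFamily φ t s a) (invFamily φ t s b)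
        (invFamily φ t s c) (invFamily φ t s e)
      simp only [hright ht hs hst] at h1
      have h2 := fun a b => hlip hTT ht hs hst a b
      rw [← hq] at h2
      have h3 : max ‖invFamily φ t s a - invFamily φ t s b‖
          ‖invFamily φ t s c - invFamily φ t s e‖ ≤ q * max ‖a - b‖ ‖c - e‖ :=
        max_le ((h2 a b).trans (by gcongr; exact le_max_left _ _))
          ((h2 c e).trans (by gcongr; exact le_max_right _ _))
      have h4 : max ‖invFamily φ t s a - invFamily φ t s c‖
          ‖invFamily φ t s b - invFamily φ t s e‖ ≤ q * max ‖a - c‖ ‖b - e‖ :=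
        max_le ((h2 a c).trans (by gcongr; exact le_max_left _ _))
          ((h2 b e).trans (by gcongr; exact le_max_right _ _))
      have h5 : hat s t (max ‖invFamily φ t s a - invFamily φ t s b‖
          ‖invFamily φ t s c - invFamily φ t s e‖) ≤ hat s t (q * max ‖a - b‖ ‖c - e‖) :=
        hc.hat_mono (mem_Ici.2 (by positivity)) (mem_Ici.2 (by positivity)) h3
      have h6 : 0 ≤ hat s t (q * max ‖a - b‖ ‖c - e‖) := hc.hat_nonneg _ (by positivity)
      have h7 := hcq hTT ht hs hst
      rw [← hq] at h7
      have h8 := mul_le_mul h5 h4 (by positivity) h6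
      have h9 := mul_le_mul h7 h8 (mul_nonneg (hc.hat_nonneg _ (by positivity)) (by positivity))
        hq0
      rw [mul_add] at h1
      calc _ ≤ _ := h1
        _ ≤ 1 / (2 - check s t) * ‖a - b - c + e‖ +
            q * (hat s t (q * max ‖a - b‖ ‖c - e‖) * (q * max ‖a - c‖ ‖b - e‖)) := by
          gcongr
        _ = _ := by ring
  · intro u hu s hs t ht v hv hus hst htv x hx
    exact mul_le_mul_of_nonneg_left (hφ.fourPoints.hat_le v (hinc hv) t (hinc ht) s (hinc hs)
      u (hinc hu) htv hst hus _ (mul_nonneg hq0 hx)) (by positivity)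
  · intro α hα
    obtain ⟨K', hK', hb⟩ := hφ.fourPoints.compat (q * α) (by positivity)
    refine ⟨q ^ 2 * K', by positivity, fun s hs t ht hst => ?_⟩
    have := hb t (hinc ht) s (hinc hs) hst
    rw [ctrl_of_le hst] at this
    rw [ctrl_of_ge hst, mul_assoc, ← mul_assoc q]
    gcongr
  · intro U hU s hs t ht hst
    rw [hδ' hU]
    exact hcq hU ht hs hst
  · refine ⟨q * (C * q ^ 2 + K * q ^ 2), by positivity, fun r hr s hs t ht hrs hst a b => ?_⟩
    have htr := hst.le.trans hrs
    rw [ctrl_of_ge htr]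
    have hx := hϖnn ht hr htr
    have h1 := halmost r hr s hs t ht hrs hst a
    have h2 := halmost r hr s hs t ht hrs hst b
    have h3 := hCb t (hinc ht) s (hinc hs) r (hinc hr) hst hrs
      (invFamily φ t s (invFamily φ s r a)) (invFamily φ t s (invFamily φ s r b))
    have h4 := (hlip hTT ht hs hst (invFamily φ s r a) (invFamily φ s r b)).trans
      (mul_le_mul_of_nonneg_left (hlip hTT hs hr hrs a b) hq0)
    have h5 := hlip hTT ht hr htr a b
    rw [← hq] at h4 h5
    rw [hright ht hs hst, hright ht hs hst, hright hs hr hrs, hright hs hr hrs,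
      ctrl_of_le htr] at h3
    have hya := hright ht hr htr a
    have hyb := hright ht hr htr b
    have hc := hφ.fourPoints.control t (hinc ht) r (hinc hr) htr
    have hKr := hKb t (hinc ht) r (hinc hr) htr
    rw [ctrl_of_le htr] at hKr
    -- `φ r t` maps the direct inverses back to `a` and `b`, so the right side contains exactly a
    -- difference of defects of `φ`, controlled by `C`.
    have h6 := (hχ t (hinc ht) r (hinc hr) htr).norm_le_of_sub_id
      (by linarith [hcpos ht hr htr]) (invFamily φ t s (invFamily φ s r a)) (invFamily φ t r a)
      (invFamily φ t s (invFamily φ s r b)) (invFamily φ t r b)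
    rw [hya, hyb] at h6
    generalize invFamily φ t s (invFamily φ s r a) = xa at *
    generalize invFamily φ t s (invFamily φ s r b) = xb at *
    generalize invFamily φ t r a = ya at *
    generalize invFamily φ t r b = yb at *
    have h7 : ‖xa - xb‖ ≤ q ^ 2 * ‖a - b‖ := h4.trans_eq (by ring)
    have h8 : ‖ya - yb‖ ≤ q ^ 2 * ‖a - b‖ := h5.trans (by gcongr; nlinarith)
    have h9 : hat r t (max ‖xa - ya‖ ‖xb - yb‖) ≤ K * ϖ (ω t r) :=
      (hc.hat_mono (mem_Ici.2 (by positivity)) (mem_Ici.2 (by positivity))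
        (max_le h1 h2)).trans hKr
    have h10 := mul_le_mul h9 (max_le h7 h8) (by positivity) (mul_nonneg hK hx)
    have h11 : ‖φ r t xa - a - φ r t xb + b‖ ≤ C * ϖ (ω t r) * (q ^ 2 * ‖a - b‖) := by
      rw [show φ r t xa - a - φ r t xb + b = -(a - φ r t xa - (b - φ r t xb)) by abel, norm_neg]
      exact h3.trans (by gcongr)
    have h12 := hcq hTT ht hr htr
    rw [← hq] at h12
    rw [show xa - ya - (xb - yb) = xa - ya - xb + yb by abel]
    calc _ ≤ _ := h6
      _ ≤ q * (C * ϖ (ω t r) * (q ^ 2 * ‖a - b‖) + K * ϖ (ω t r) * (q ^ 2 * ‖a - b‖)) := by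
        have : 0 ≤ hat r t (max ‖xa - ya‖ ‖xb - yb‖) := hc.hat_nonneg _ (by positivity)
        gcongr
      _ = _ := by ring

end Inverse

/-! ### Restriction, congruence and inversion of flows. -/

section Flow

variable {V : Type*} {T : ℝ}

theorem IsFlow.restrict {ψ : ℝ → ℝ → V → V} {U : ℝ} (h : IsFlow T ψ) (hU : U ≤ T) :
    IsFlow U ψ where
  refl t ht := h.refl t ⟨ht.1, ht.2.trans hU⟩
  inv s hs t ht := h.inv s ⟨hs.1, hs.2.trans hU⟩ t ⟨ht.1, ht.2.trans hU⟩
  comp r hr s hs t ht := h.comp r ⟨hr.1, hr.2.trans hU⟩ s ⟨hs.1, hs.2.trans hU⟩ t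
    ⟨ht.1, ht.2.trans hU⟩

theorem IsFlow.congr {ψ θ : ℝ → ℝ → V → V} (h : IsFlow T ψ)
    (hθ : ∀ s ∈ Icc 0 T, ∀ t ∈ Icc 0 T, θ t s = ψ t s) : IsFlow T θ where
  refl t ht := (hθ t ht t ht).trans (h.refl t ht)
  inv s hs t ht hst := by
    rw [hθ s hs t ht, hθ t ht s hs]; exact h.inv s hs t ht hst
  comp r hr s hs t ht hrst := by
    rw [hθ s hs t ht, hθ r hr s hs, hθ r hr t ht]; exact h.comp r hr s hs t ht hrst

/-- A flow already contains its inverses at the reversed indices. -/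
theorem IsFlow.invFamily_eq [NormedAddCommGroup V] {ψ : ℝ → ℝ → V → V} (h : IsFlow T ψ) {s t : ℝ} (hs : s ∈ Icc 0 T)
    (ht : t ∈ Icc 0 T) : invFamily ψ t s = ψ t s := by
  have hinj : Function.Injective (ψ s t) :=
    Function.LeftInverse.injective (g := ψ t s) (h.symm_apply ht hs)
  funext a
  have := Function.leftInverse_invFun hinj (ψ t s a)
  rwa [h.symm_apply hs ht] at this

end Flow

/-! ### Existence and uniqueness of the flow in a galaxy -/

section Galaxy

variable {V : Type*} [NormedAddCommGroup V] {T₀ T : ℝ} {ω : ℝ → ℝ → ℝ} {ϖ δ : ℝ → ℝ}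
  {φ : ℝ → ℝ → V → V} {hat : ℝ → ℝ → ℝ → ℝ} {check : ℝ → ℝ → ℝ}

/-- `c` is fixed first, because `H` depends on the threshold `2 * L + M` with `L = c * M`. None of
the constants depends on `T`, which may therefore be taken small afterwards. -/
theorem IsStableAlmostFlowWith.exists_uniformStable (hω : IsControl T₀ ω) (hϖ : IsRemainder ϖ)
    (hφ : IsStableAlmostFlowWith T₀ δ ϖ ω φ hat check) {c : ℝ} (hc : 0 ≤ c) :
    ∃ M C H, 0 ≤ M ∧ 0 ≤ C ∧ 0 ≤ H ∧ ∀ T ∈ Ioc 0 T₀,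
      UniformStable T (δ T) M C (2 * (c * M) + M) H ϖ ω φ := by
  obtain ⟨M, hM, hMb⟩ := hφ.almostFlow.almost
  obtain ⟨C, hC, hCb⟩ := hφ.lip
  obtain ⟨H, hH, hHb⟩ := hφ.fourPoints.compat (2 * (c * M) + M) (by positivity)
  refine ⟨M, C, H, hM, hC, hH, fun T hT => ?_⟩
  have hinc : ∀ {s}, s ∈ Icc 0 T → s ∈ Icc 0 T₀ := fun hs => ⟨hs.1, hs.2.trans hT.2⟩
  refine ⟨fun t ht => hφ.almostFlow.refl t (hinc ht), ?_, ?_, ?_, ?_⟩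
  · intro s t hs hst ht a b
    simpa using hφ.almostFlow.regular T hT s ⟨hs, hst.trans ht⟩ t ⟨hs.trans hst, ht⟩ hst b a
  · intro r s t hr hrs hst ht a
    have := hMb r (hinc ⟨hr, by linarith⟩) s (hinc ⟨by linarith, by linarith⟩) t
      (hinc ⟨by linarith, ht⟩) hrs hst a
    rwa [ctrl_of_le (hrs.trans hst)] at this
  · intro r s t hr hrs hst ht a b
    have := hCb r (hinc ⟨hr, by linarith⟩) s (hinc ⟨by linarith, by linarith⟩) t
      (hinc ⟨by linarith, ht⟩) hrs hst a b
    rwa [ctrl_of_le (hrs.trans hst)] at this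
  · intro r s t v hr hrs hst htv hv a b x y hab hxy
    have hr' : r ∈ Icc 0 T := ⟨hr, by linarith⟩
    have hs' : s ∈ Icc 0 T := ⟨by linarith, by linarith⟩
    have ht' : t ∈ Icc 0 T := ⟨by linarith, by linarith⟩
    have hv' : v ∈ Icc 0 T := ⟨by linarith, hv⟩
    have hrv : r ≤ v := hrs.trans (hst.trans htv)
    have hx := hϖ.nonneg _ (hω.nonneg r v hr hrv (hinc hv').2)
    have h1 := hφ.fourPoints.control s (hinc hs') t (hinc ht') hst
    have h2 := hφ.fourPoints.hat_le r (hinc hr') s (hinc hs') t (hinc ht') v (hinc hv') hrs hst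
      htv ((2 * (c * M) + M) * ϖ (ω r v)) (by positivity)
    have h3 := hHb r (hinc hr') v (hinc hv') hrv
    rw [ctrl_of_le hrv] at h3
    have h4 := h1.hat_mono (mem_Ici.2 (by positivity)) (mem_Ici.2 (by positivity))
      (max_le hab hxy)
    refine (h1.bound a b x y).trans ?_
    gcongr
    · exact h4.trans (h2.trans h3)
    · exact hφ.check_le T hT s hs' t ht' hst

variable [CompleteSpace V]

theorem IsStableAlmostFlowWith.exists_flow (hT₀ : 0 < T₀) (hω : IsControl T₀ ω)
    (hϖ : IsRemainder ϖ) (hδ : IsModulus δ)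
    (hφ : IsStableAlmostFlowWith T₀ δ ϖ ω φ hat check)
    (hχ_lip : ∀ T ∈ Ioc 0 T₀, ∀ s ∈ Icc 0 T, ∀ t ∈ Icc 0 T, s ≤ t →
      ∀ a b, ‖(φ t s a - a) - (φ t s b - b)‖ ≤ δ T * ‖a - b‖) :
    ∃ T ∈ Ioc 0 T₀, δ T < 1 ∧ ∃ (ψ : ℝ → ℝ → V → V) (L k : ℝ), 0 ≤ k ∧ k < 1 ∧ IsFlow T ψ ∧
      (∀ s t, 0 ≤ s → s ≤ t → t ≤ T → ∀ a, ‖φ t s a - ψ t s a‖ ≤ L * ϖ (ω s t)) ∧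
      (∀ s t, 0 ≤ s → s ≤ t → t ≤ T → ∀ a b,
        ‖(ψ t s a - a) - (ψ t s b - b)‖ ≤ k * ‖a - b‖) := by
  obtain ⟨κ, hκ0, hκ1, hκ⟩ := hϖ.half_le
  have hκ' : 0 < 1 - κ := by linarith
  obtain ⟨M, C, H, hM, hC, hH, hstable⟩ :=
    hφ.exists_uniformStable hω hϖ (c := 6 / (1 - κ)) (by positivity)
  set L := 6 / (1 - κ) * M with hLdef
  set K := 2 * (12 * H + 3 * C) / (1 - κ) with hKdef
  have hL : 6 * M ≤ L * (1 - κ) := by rw [hLdef]; field_simp; exact le_rfl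
  have hK : 2 * (12 * H + 3 * C) ≤ K * (1 - κ) := by rw [hKdef]; field_simp; exact le_rfl
  have hL0 : 0 ≤ L := by positivity
  have hK0 : 0 ≤ K := by positivity
  set e := (1 - κ) / 10 with he
  have he0 : 0 < e := by positivity
  obtain ⟨x₀, hx₀, hxle⟩ := hϖ.eventually_le_mul (e := e / (K + 1)) (by positivity)
  -- The bound `x₀` makes `ϖ (ω 0 T)` at most `e / (K + 1) * ω 0 T`, and the bound `1` removes the
  -- factor `ω 0 T`.
  obtain ⟨η, hη, hωη⟩ := hω.uniform_diag (e := min x₀ 1) (by positivity)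
  obtain ⟨T, hδT, hTη, hTT₀, hT0⟩ : ∃ T, δ T < e ∧ T < η ∧ T ≤ T₀ ∧ 0 < T := by
    have h1 : ∀ᶠ T in 𝓝[>] (0 : ℝ), T < η := nhdsWithin_le_nhds (gt_mem_nhds hη)
    have h2 : ∀ᶠ T in 𝓝[>] (0 : ℝ), T < T₀ := nhdsWithin_le_nhds (gt_mem_nhds hT₀)
    obtain ⟨T, h⟩ := ((hδ.tendsto.eventually (gt_mem_nhds he0)).and
      (h1.and (h2.and self_mem_nhdsWithin))).exists
    exact ⟨T, h.1, h.2.1, h.2.2.1.le, h.2.2.2⟩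
  have hT : T ∈ Ioc 0 T₀ := ⟨hT0, hTT₀⟩
  have hωT := hω.restrict hTT₀
  have hW := hωT.nonneg 0 T le_rfl hT0.le le_rfl
  have hKT : K * ϖ (ω 0 T) ≤ e := by
    have h1 := hωη 0 T le_rfl hT0.le hTT₀ (by linarith)
    have h2 := hxle _ hW (h1.le.trans (min_le_left _ _))
    have h3 := h1.le.trans (min_le_right _ _)
    calc K * ϖ (ω 0 T) ≤ K * (e / (K + 1) * 1) := by
          gcongr; exact h2.trans (by gcongr)
      _ = K / (K + 1) * e := by field_simp
      _ ≤ 1 * e := by gcongr; rw [div_le_one (by linarith)]; linarith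
      _ = e := one_mul e
  have hd0 := hδ.nonneg T hT0.le
  have hU := hstable T hT
  -- One `e` comes from the distance of the composition to `φ`, the other from `δ T < e`; `2 * e <
  -- 1` makes the limit maps bijective.
  have hlip : ∀ τ : ℕ → ℝ, Monotone τ → (∀ i, τ i ∈ Icc 0 T) → ∀ i n a b,
      ‖(iterComp (stepMap φ τ) i n a - a) - (iterComp (stepMap φ τ) i n b - b)‖ ≤
        (2 * e) * ‖a - b‖ := by
    intro τ hτ hτT i n a b
    have h1 := hU.lip_iterComp_sub hωT hϖ hκ0 hκ1 hκ hd0 hδT.le hM hC hH hL rfl hK hKT hτ hτT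
      i n a b
    have hle : τ i ≤ τ (i + n) := hτ (by omega)
    have h2 := hχ_lip T hT (τ i) (hτT i) (τ (i + n)) (hτT _) hle a b
    have h3 : K * ϖ (ω (τ i) (τ (i + n))) ≤ e := by
      refine le_trans ?_ hKT
      gcongr
      exact hϖ.mono (hωT.nonneg _ _ (hτT i).1 hle (hτT _).2) hW
        (hωT.mono le_rfl (hτT i).1 hle (hτT _).2 le_rfl)
    have h4 := mul_le_mul_of_nonneg_right h3 (norm_nonneg (a - b))
    have h5 := mul_le_mul_of_nonneg_right hδT.le (norm_nonneg (a - b))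
    have h6 := norm_add_le ((iterComp (stepMap φ τ) i n a - φ (τ (i + n)) (τ i) a) -
      (iterComp (stepMap φ τ) i n b - φ (τ (i + n)) (τ i) b))
      ((φ (τ (i + n)) (τ i) a - a) - (φ (τ (i + n)) (τ i) b - b))
    rw [show (iterComp (stepMap φ τ) i n a - φ (τ (i + n)) (τ i) a) -
      (iterComp (stepMap φ τ) i n b - φ (τ (i + n)) (τ i) b) +
      ((φ (τ (i + n)) (τ i) a - a) - (φ (τ (i + n)) (τ i) b - b)) =
      (iterComp (stepMap φ τ) i n a - a) - (iterComp (stepMap φ τ) i n b - b) by abel] at h6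
    linarith
  obtain ⟨ψ, hψ1, hψ2, hψ3, hψ4⟩ := exists_sewing hT0.le hωT hϖ hU.refl hL0 hM
    (by positivity : 0 ≤ 2 * e) hU.almost
    (fun τ hτ hτT => hU.norm_iterComp_sub_le hωT hϖ hκ0 hκ1 hκ hd0 hδT.le hM hL hτ hτT) hlip
  have he1 : 2 * e < 1 := by linarith
  obtain ⟨θ, hθ, hθψ⟩ := exists_isFlow_of_comp hψ1 hψ2 fun s t hs hst ht =>
    bijective_of_sub_id_lip (hψ4 s t hs hst ht) (by positivity) he1
  refine ⟨T, hT, by linarith, θ, L, 2 * e, by positivity, he1, hθ, fun s t hs hst ht => ?_,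
    fun s t hs hst ht => ?_⟩
  · rw [hθψ s t hst]; exact hψ3 s t hs hst ht
  · rw [hθψ s t hst]; exact hψ4 s t hs hst ht

end Galaxy

/-! ### The proposition. -/

theorem mainTheorem9 {V : Type*} [NormedAddCommGroup V] [NormedSpace ℝ V] [CompleteSpace V]
    (T₀ : ℝ) (hT₀ : 0 < T₀)
    (ω : ℝ → ℝ → ℝ) (hω : IsControl T₀ ω)
    (ϖ : ℝ → ℝ) (hϖ : IsRemainder ϖ)
    (δ : ℝ → ℝ) (hδ : IsModulus δ)
    (φ : ℝ → ℝ → V → V) (hat : ℝ → ℝ → ℝ → ℝ) (check : ℝ → ℝ → ℝ)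
    (hφ : IsStableAlmostFlowWith T₀ δ ϖ ω φ hat check)
    (hχ : ∀ s ∈ Icc 0 T₀, ∀ t ∈ Icc 0 T₀, s ≤ t →
      FourPointsControl (fun a => φ t s a - a) (hat t s) (check t s - 1))
    (hχ_lip : ∀ T ∈ Ioc 0 T₀, ∀ s ∈ Icc 0 T, ∀ t ∈ Icc 0 T, s ≤ t →
      ∀ a b, ‖(φ t s a - a) - (φ t s b - b)‖ ≤ δ T * ‖a - b‖) :
    (∀ T ∈ Ioc 0 T₀, δ T < 1 →
      (∀ s ∈ Icc 0 T, ∀ t ∈ Icc 0 T, s ≤ t → Function.Bijective (φ t s)) ∧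
      IsReverseStableAlmostFlow T (fun u => δ u / (1 - δ u)) ϖ ω (invFamily φ)) ∧
    ∃ T₁ ∈ Ioc 0 T₀, δ T₁ < 1 ∧ ∀ T ∈ Ioc 0 T₁, ∃ ψ : ℝ → ℝ → V → V,
      IsUniqueFlowInGalaxy (· ≤ ·) T ϖ ω φ ψ ∧
      IsUniqueFlowInGalaxy (· ≥ ·) T ϖ ω (invFamily φ) (invFamily ψ) := by
  have hbij : ∀ T ∈ Ioc 0 T₀, δ T < 1 →
      ∀ s ∈ Icc 0 T, ∀ t ∈ Icc 0 T, s ≤ t → Function.Bijective (φ t s) :=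
    fun T hT hδT s hs t ht hst => bijective_of_sub_id_lip (hχ_lip T hT s hs t ht hst)
      (hδ.nonneg T hT.1.le) hδT
  refine ⟨fun T hT hδT => ⟨hbij T hT hδT, hφ.reverse hω hϖ hδ hχ hχ_lip hT hδT⟩, ?_⟩
  obtain ⟨T₁, hT₁, hδT₁, ψ, L, k, hk0, hk1, hψ₁, hclose₁, hcontr₁⟩ :=
    hφ.exists_flow hT₀ hω hϖ hδ hχ_lip
  refine ⟨T₁, hT₁, hδT₁, fun T hT => ⟨ψ, ?_⟩⟩
  have hT' : T ∈ Ioc 0 T₀ := ⟨hT.1, hT.2.trans hT₁.2⟩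
  have hδT : δ T < 1 :=
    (hδ.mono (mem_Ici.2 hT.1.le) (mem_Ici.2 hT₁.1.le) hT.2).trans_lt hδT₁
  have hinc : ∀ {s}, s ∈ Icc 0 T → s ∈ Icc 0 T₀ := fun hs => ⟨hs.1, hs.2.trans hT'.2⟩
  have hωT := hω.restrict hT'.2
  have hψ := hψ₁.restrict hT.2
  have hclose : ∀ s t, 0 ≤ s → s ≤ t → t ≤ T → ∀ a, ‖φ t s a - ψ t s a‖ ≤ L * ϖ (ω s t) :=
    fun s t hs hst ht => hclose₁ s t hs hst (ht.trans hT.2)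
  have hcontr : ∀ s t, 0 ≤ s → s ≤ t → t ≤ T → ∀ a b,
      ‖(ψ t s a - a) - (ψ t s b - b)‖ ≤ k * ‖a - b‖ :=
    fun s t hs hst ht => hcontr₁ s t hs hst (ht.trans hT.2)
  have hφlip := fun s hs t ht hst => norm_sub_le_of_sub_id_lip (hχ_lip T hT' s hs t ht hst)
  have hφinv := fun s hs t ht hst => norm_le_of_sub_id_lip (hχ_lip T hT' s hs t ht hst) hδT
  have hright : ∀ {s t}, s ∈ Icc 0 T → t ∈ Icc 0 T → s ≤ t → ∀ a,
      φ t s (invFamily φ s t a) = a :=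
    fun hs ht hst => Function.rightInverse_invFun (hbij T hT' hδT _ hs _ ht hst).2
  -- Uniqueness in both galaxies rests on this statement.
  have huniq : ∀ (θ : ℝ → ℝ → V → V) (C : ℝ), IsFlow T θ →
      (∀ s t, 0 ≤ s → s ≤ t → t ≤ T → ∀ a, ‖φ t s a - θ t s a‖ ≤ C * ϖ (ω s t)) →
      ∀ s ∈ Icc 0 T, ∀ t ∈ Icc 0 T, θ t s = ψ t s := by
    intro θ C hθ hC s hs t ht
    refine hψ.eq_of_norm_sub_le (Λ := 1 + k) (C := L + C) hT.1.le hωT hϖ hθ (by linarith)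
      (fun s t hs hst ht => norm_sub_le_of_sub_id_lip (hcontr s t hs hst ht)) ?_ hs ht
    intro s t hs hst ht a
    have h1 := hclose s t hs hst ht a
    have h2 := hC s t hs hst ht a
    have h3 := norm_sub_le_norm_sub_add_norm_sub (ψ t s a) (φ t s a) (θ t s a)
    rw [norm_sub_rev (ψ t s a) (φ t s a)] at h3
    linarith
  have hψfam := fun {s t} (hs : s ∈ Icc 0 T) (ht : t ∈ Icc 0 T) => hψ.invFamily_eq hs ht
  refine ⟨⟨hψ, ⟨fun s hs t ht => hφ.almostFlow.family s (hinc hs) t (hinc ht),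
    fun s hs t ht hst => ?_, L, fun s hs t ht hst a => ?_⟩, ?_⟩,
    hψ.congr fun s hs t ht => hψfam hs ht,
    ⟨fun s hs t ht hst => ?_, fun s hs t ht hst => ?_, 1 / (1 - δ T) * L,
      fun s hs t ht hst a => ?_⟩, ?_⟩
  · exact continuous_of_norm_sub_le
      (norm_sub_le_of_sub_id_lip (hcontr s t hs.1 hst ht.2))
  · rw [ctrl_of_le hst]
    exact hclose s t hs.1 hst ht.2 a
  · rintro θ hθ ⟨-, -, C, hC⟩
    refine huniq θ C hθ fun s t hs hst ht a => ?_
    rw [← ctrl_of_le (ω := ω) hst]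
    exact hC s ⟨hs, hst.trans ht⟩ t ⟨hs.trans hst, ht⟩ hst a
  · refine continuous_of_norm_sub_le (c := 1 / (1 - δ T)) fun a b => ?_
    have := hφinv t ht s hs hst (invFamily φ t s a) (invFamily φ t s b)
    rwa [hright ht hs hst, hright ht hs hst] at this
  · rw [hψfam hs ht]
    refine continuous_of_norm_sub_le (c := 1 / (1 - k)) fun a b => ?_
    have := norm_le_of_sub_id_lip (hcontr t s ht.1 hst hs.2) hk1 (ψ t s a) (ψ t s b)
    rwa [hψ.symm_apply hs ht, hψ.symm_apply hs ht] at this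
  · rw [hψfam hs ht, ctrl_of_ge hst]
    have h1 := hφinv t ht s hs hst (invFamily φ t s a) (ψ t s a)
    have h2 := hclose t s ht.1 hst hs.2 (ψ t s a)
    rw [hright ht hs hst, norm_sub_rev a] at h1
    rw [hψ.symm_apply hs ht] at h2
    rw [mul_assoc]
    refine h1.trans (mul_le_mul_of_nonneg_left h2 ?_)
    exact (one_div_pos.2 (by linarith)).le
  · rintro θ hθ ⟨-, -, C, hC⟩ s hs t ht
    rw [hψfam hs ht]
    -- The closeness of `θ` to the inverses, taken at `θ t s a` and pushed forward by the `(1 + δ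
    -- T)`-Lipschitz map `φ t s`, becomes closeness of `θ` to `φ`.
    refine huniq θ ((1 + δ T) * C) hθ (fun s t hs hst ht a => ?_) s hs t ht
    have hs' : s ∈ Icc 0 T := ⟨hs, hst.trans ht⟩
    have ht' : t ∈ Icc 0 T := ⟨hs.trans hst, ht⟩
    have h1 := hC t ht' s hs' hst (θ t s a)
    rw [hθ.symm_apply hs' ht', ctrl_of_ge hst] at h1
    have h2 := hφlip s hs' t ht' hst a (invFamily φ s t (θ t s a))
    rw [hright hs' ht' hst, norm_sub_rev a] at h2
    rw [mul_assoc]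
    exact h2.trans (mul_le_mul_of_nonneg_left h1 (by linarith [hδ.nonneg T hT.1.le]))
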